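/- Let $\Omega\subset\mathbb{R}^2\cong\mathbb{C}$ be the open unit disc and $\Gamma$ the unit circle, and let $\partial=(\partial_x-i\partial_y)/2$, $\overline\partial=(\partial_x+i\partial_y)/2$. Consider sequences $\mathbf u=\langle u_0,u_{-1},u_{-2},\dots\rangle$ of complex-valued functions, with the left translation $L\langle u_0,u_{-1},u_{-2},\dots\rangle=\langle u_{-1},u_{-2},\dots\rangle$; derivatives act componentwise (in the weak sense). For $p\ge 0$ and $q\in\{0,1\}$ let $l^{2,p}(\mathbb{N};H^q(\Omega))$ be the set of those $\mathbf u$ with $$\|\mathbf u\|_{p,q}^2:=\sum_{j=0}^\infty(1+j^2)^p\,\|u_{-j}\|_{H^q(\Omega)}^2<\infty ,\qquad H^0(\Omega)=L^2(\Omega),$$ and write $\|\mathbf u\|=\|\mathbf u\|_{0,0}$. For sequences $\mathbf g$ of functions on $\Gamma$ with Fourier expansions $g_{-j}(e^{i\beta})=\sum_{n\in\mathbb{Z}}g_{-j,n}e^{in\beta}$, let $$\|\mathbf g\|_{\frac12,\frac12}^2:=\sum_{j=0}^\infty\sum_{n=-\infty}^\infty(1+j^2)^{\frac12}(1+n^2)^{\frac12}|g_{-j,n}|^2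 ,$$ and let $l^{2,\frac12}(\mathbb{N};H^{\frac12}(\Gamma))$ be the set of those $\mathbf g$ for which this is finite. Let $\mathbf f\in l^{2,1}(\mathbb{N};L^2(\Omega))$. If $\mathbf v\in l^{2,\frac12}(\mathbb{N};H^1(\Omega))$ solves $$\overline\partial\mathbf v+L^2\partial\mathbf v=\mathbf f\quad\text{in }\Omega,$$ then its componentwise trace $\mathbf v|_\Gamma$ (exists, is unique and) belongs to $l^{2,\frac12}(\mathbb{N};H^{\frac12}(\Gamma))$, and $$\|\partial\mathbf v\|^2\le 12\,\|\mathbf f\|_{1,0}^2+2\pi\,\bigl\|\mathbf v|_\Gamma\bigr\|_{\frac12,\frac12}^2 .$$ -/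

import Mathlib

open MeasureTheory Filter Topology
open scoped ENNReal ContDiff

noncomputable section

namespace BukhgeimBeltrami

/-- The open unit disc `Ω` of the plane `ℝ² = ℂ`. -/
def disc : Set ℂ := Metric.ball 0 1

/-- The space `L²(Ω)` of complex functions, with respect to area measure. -/
abbrev L2 (Ω : Set ℂ) : Type := Lp ℂ 2 ((volume : Measure ℂ).restrict Ω)

/-- `w` is the weak derivative of `u` on `Ω` in the direction `e` (`e = 1` gives `∂_x`,
`e = i` gives `∂_y`), tested against smooth functions with compact support in `Ω`. -/
def IsWeakDeriv (Ω : Set ℂ) (e : ℂ) (u w : L2 Ω) : Prop :=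
  ∀ φ : ℂ → ℂ, ContDiff ℝ ∞ φ → HasCompactSupport φ → tsupport φ ⊆ Ω →
    ∫ z in Ω, u z * fderiv ℝ φ z e = -∫ z in Ω, w z * φ z

/-- The Sobolev space `H¹(Ω)`: functions in `L²(Ω)` with weak partial derivatives in `L²(Ω)`.
The derivatives are determined by the function, so recording them adds no data. -/
structure H1 (Ω : Set ℂ) where
  /-- the function -/
  val : L2 Ω
  /-- its weak derivative in `x` -/
  dx : L2 Ω
  /-- its weak derivative in `y` -/
  dy : L2 Ω
  isWeakDeriv_dx : IsWeakDeriv Ω 1 val dx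
  isWeakDeriv_dy : IsWeakDeriv Ω Complex.I val dy

/-- `∂ = (∂_x - i ∂_y) / 2`. -/
def H1.del {Ω : Set ℂ} (u : H1 Ω) : L2 Ω := (1 / 2 : ℂ) • (u.dx - Complex.I • u.dy)

/-- `∂̄ = (∂_x + i ∂_y) / 2`. -/
def H1.delbar {Ω : Set ℂ} (u : H1 Ω) : L2 Ω := (1 / 2 : ℂ) • (u.dx + Complex.I • u.dy)

/-- The squared `H¹(Ω)` norm. -/
def H1.normSq {Ω : Set ℂ} (u : H1 Ω) : ℝ≥0∞ := ‖u.val‖ₑ ^ 2 + ‖u.dx‖ₑ ^ 2 + ‖u.dy‖ₑ ^ 2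

instance factTwoPiPos : Fact (0 < 2 * Real.pi) := ⟨Real.two_pi_pos⟩

/-- `L²(Γ)` for the unit circle `Γ`, parametrized by the angle `β ∈ ℝ / 2πℤ`, with respect to
the normalized arc length `dβ / 2π`. -/
abbrev L2Circle : Type := Lp ℂ 2 (AddCircle.haarAddCircle (T := 2 * Real.pi))

/-- The squared `H^{1/2}(Γ)` norm `∑ₖ (1 + k²)^{1/2} |gₖ|²`, where `g(e^{iβ}) = ∑ₖ gₖ e^{ikβ}`. -/
def halfNormSq (g : L2Circle) : ℝ≥0∞ :=
  ∑' k : ℤ, ENNReal.ofReal ((1 + (k : ℝ) ^ 2) ^ (1 / 2 : ℝ)) * ‖fourierCoeff g k‖ₑ ^ 2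

/-- `g` is the trace on the unit circle of `u ∈ H¹(Ω)`, `Ω` the unit disc: there are functions,
smooth up to the boundary, that converge to `u` in `H¹(Ω)` and whose restrictions to the circle
converge to `g` in `L²(Γ)`. -/
def IsTrace (u : H1 disc) (g : L2Circle) : Prop :=
  ∃ φ : ℕ → ℂ → ℂ, (∀ n, ContDiff ℝ ∞ (φ n)) ∧
    Tendsto (fun n => eLpNorm (fun z => φ n z - u.val z) 2 (volume.restrict disc))
      atTop (𝓝 0) ∧
    Tendsto (fun n => eLpNorm (fun z => fderiv ℝ (φ n) z 1 - u.dx z) 2 (volume.restrict disc))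
      atTop (𝓝 0) ∧
    Tendsto (fun n => eLpNorm (fun z => fderiv ℝ (φ n) z Complex.I - u.dy z) 2
      (volume.restrict disc)) atTop (𝓝 0) ∧
    Tendsto (fun n => eLpNorm (fun β : AddCircle (2 * Real.pi) =>
      φ n (AddCircle.toCircle β : ℂ) - g β) 2 AddCircle.haarAddCircle) atTop (𝓝 0)

/-- The weighted sum `∑ⱼ (1 + j²)^p aⱼ`; with `aⱼ` the squared norm of the component of index `-j`
of a sequence `⟨u₀, u₋₁, u₋₂, …⟩`, this is the squared norm of the sequence in `l^{2,p}`. -/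
def weightedSum (p : ℝ) (a : ℕ → ℝ≥0∞) : ℝ≥0∞ :=
  ∑' j : ℕ, ENNReal.ofReal ((1 + (j : ℝ) ^ 2) ^ p) * a j

/-- The squared norm `‖f‖²_{p,0}` of `l^{2,p}(ℕ; L²(Ω))`. -/
def normSqL2 (p : ℝ) {Ω : Set ℂ} (f : ℕ → L2 Ω) : ℝ≥0∞ := weightedSum p fun j => ‖f j‖ₑ ^ 2

/-- The squared norm `‖v‖²_{p,1}` of `l^{2,p}(ℕ; H¹(Ω))`. -/
def normSqH1 (p : ℝ) {Ω : Set ℂ} (v : ℕ → H1 Ω) : ℝ≥0∞ := weightedSum p fun j => (v j).normSq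

/-- The squared norm `‖g‖²_{p,1/2}` of `l^{2,p}(ℕ; H^{1/2}(Γ))`. -/
def normSqHalf (p : ℝ) (g : ℕ → L2Circle) : ℝ≥0∞ := weightedSum p fun j => halfNormSq (g j)

/-- The left translation `L⟨u₀, u₋₁, u₋₂, …⟩ = ⟨u₋₁, u₋₂, …⟩`. -/
def leftShift {X : Type*} (u : ℕ → X) : ℕ → X := fun j => u (j + 1)

end BukhgeimBeltrami

end

/-! For `F` smooth up to the boundary, `|∂F|² - |∂̄F|²` is a divergence, so its integral over the
disc depends only on boundary values: it equals `π ∑ n |F_n|²`, where `F_n` are the Fourier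
coefficients of `F` on the circle (`setIntegral_dz_sub_dzbar`). Since `n ≤ (1 + n²)^{1/2}`, this
gives `‖∂F‖² ≤ ‖∂̄F‖² + π ‖F|_Γ‖²_{1/2}`.

To pass to `H¹`, two facts are needed. Smooth functions are dense (`exists_smooth_approx`): extend
by zero, mollify at scale `1 - r`, and dilate by `r`, so that inside the disc the mollifier never
sees the artificial jump at the boundary. The trace is bounded from `H¹` to `H^{1/2}`
(`exists_halfNormSq_circLp_le`): Green's formula gives `⟨z^k, ∂F⟩ = π F_{k+1}`, so Bessel's
inequality for the orthogonal monomials bounds the positive modes by `∂F`. Conjugation bounds the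
negative modes by `∂̄F`, and the zero mode is estimated directly. Existence and uniqueness of the
trace follow, and the energy inequality extends to `enorm_del_sq_le`.

The equation reads `∂̄v_j = f_j - ∂v_{j+2}`, with `v_j` the component of index `-j`. With `a_j =
‖∂v_j‖` the energy inequality becomes `a_j² ≤ (‖f_j‖ + a_{j+2})² + π ‖g_j‖²_{1/2}`. Multiply by `w_j
= ⌊j/2⌋ + 1` and sum: as `w_{j+2} = w_j + 1`, the sum `∑ w_j a_{j+2}²` cancels and leaves `∑ a_j²`
on the left. The cross terms are absorbed by Young's inequality at the price of the weight `w_j² ≤ 1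
+ j²` on `f` (`tsum_sq_le_of_recursion`). -/

noncomputable section

namespace BukhgeimBeltrami

open ComplexConjugate
open scoped Convolution

/-! ### Polar coordinates and the divergence theorem on the disc -/

/-- The point of the plane with polar coordinates `(r, β)`. -/
def polarPoint (r β : ℝ) : ℂ := r * (Real.cos β + Real.sin β * Complex.I)

lemma polarPoint_eq (r β : ℝ) : polarPoint r β = r * Complex.exp (β * Complex.I) := by
  rw [polarPoint, Complex.exp_mul_I, Complex.ofReal_cos, Complex.ofReal_sin]

lemma continuous_polarPoint : Continuous fun p : ℝ × ℝ => polarPoint p.1 p.2 := by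
  unfold polarPoint; fun_prop

lemma contDiff_polarPoint : ContDiff ℝ 1 fun p : ℝ × ℝ => polarPoint p.1 p.2 := by
  unfold polarPoint
  have h := Complex.ofRealCLM.contDiff (n := 1)
  have h1 : ContDiff ℝ 1 fun p : ℝ × ℝ => ((p.1 : ℝ) : ℂ) := h.comp contDiff_fst
  have h2 : ContDiff ℝ 1 fun p : ℝ × ℝ => ((Real.cos p.2 : ℝ) : ℂ) :=
    h.comp (Real.contDiff_cos.comp contDiff_snd)
  have h3 : ContDiff ℝ 1 fun p : ℝ × ℝ => ((Real.sin p.2 : ℝ) : ℂ) :=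
    h.comp (Real.contDiff_sin.comp contDiff_snd)
  exact h1.mul (h2.add (h3.mul contDiff_const))

lemma clm_apply_eq (L : ℂ →L[ℝ] ℂ) (a b : ℝ) :
    L (a + b * Complex.I) = a * L 1 + b * L Complex.I := by
  have : (a + b * Complex.I : ℂ) = a • (1 : ℂ) + b • Complex.I := by simp
  rw [this, map_add, map_smul, map_smul]; simp

lemma hasDerivAt_radial {F : ℂ → ℂ} (hF : ContDiff ℝ 1 F) (r β : ℝ) :
    HasDerivAt (fun s : ℝ => F (polarPoint s β))
      (Real.cos β * fderiv ℝ F (polarPoint r β) 1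
        + Real.sin β * fderiv ℝ F (polarPoint r β) Complex.I) r := by
  have h1 : HasDerivAt (fun s : ℝ => polarPoint s β) (Real.cos β + Real.sin β * Complex.I) r := by
    unfold polarPoint
    simpa using (Complex.ofRealCLM.hasDerivAt (x := r)).mul_const
      (Real.cos β + Real.sin β * Complex.I : ℂ)
  have h2 := (hF.differentiable one_ne_zero (polarPoint r β)).hasFDerivAt.comp_hasDerivAt r h1
  rwa [clm_apply_eq] at h2

lemma hasDerivAt_ofReal_cos (β : ℝ) :
    HasDerivAt (fun t : ℝ => (Real.cos t : ℂ)) (-Real.sin β : ℂ) β := by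
  simpa using (Real.hasDerivAt_cos β).ofReal_comp

lemma hasDerivAt_ofReal_sin (β : ℝ) :
    HasDerivAt (fun t : ℝ => (Real.sin t : ℂ)) (Real.cos β : ℂ) β := by
  simpa using (Real.hasDerivAt_sin β).ofReal_comp

lemma hasDerivAt_angular {F : ℂ → ℂ} (hF : ContDiff ℝ 1 F) (r β : ℝ) :
    HasDerivAt (fun t : ℝ => F (polarPoint r t))
      (r * (-Real.sin β * fderiv ℝ F (polarPoint r β) 1
        + Real.cos β * fderiv ℝ F (polarPoint r β) Complex.I)) β := by
  have h1 : HasDerivAt (fun t : ℝ => polarPoint r t)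
      (((-r * Real.sin β : ℝ) : ℂ) + ((r * Real.cos β : ℝ) : ℂ) * Complex.I) β := by
    unfold polarPoint
    have := (((hasDerivAt_ofReal_cos β).add
      ((hasDerivAt_ofReal_sin β).mul_const Complex.I)).const_mul (r : ℂ))
    convert! this using 1
    push_cast; ring
  have h2 := (hF.differentiable one_ne_zero (polarPoint r β)).hasFDerivAt.comp_hasDerivAt β h1
  rw [clm_apply_eq] at h2
  convert! h2 using 1
  push_cast; ring

lemma setIntegral_disc_eq_polar (H : ℂ → ℂ) :
    ∫ z in disc, H z = ∫ p in Set.Icc ((0, -Real.pi) : ℝ × ℝ) (1, Real.pi),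
      (p.1 : ℂ) * H (polarPoint p.1 p.2) := by

  rw [disc, ← integral_indicator Metric.isOpen_ball.measurableSet,
    ← Complex.integral_comp_polarCoord_symm]
  have key : ∀ p ∈ polarCoord.target,
      p.1 • (Metric.ball (0 : ℂ) 1).indicator H (Complex.polarCoord.symm p) =
      (Set.Ioo (0 : ℝ) 1 ×ˢ Set.Ioo (-Real.pi) Real.pi).indicator
        (fun p : ℝ × ℝ => (p.1 : ℂ) * H (polarPoint p.1 p.2)) p := by
    intro p hp
    rw [polarCoord_target] at hp
    have h0 : 0 < p.1 := hp.1
    have e : Complex.polarCoord.symm p = polarPoint p.1 p.2 := by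
      rw [Complex.polarCoord_symm_apply]; rfl
    have hn : ‖Complex.polarCoord.symm p‖ = p.1 := by
      rw [Complex.norm_polarCoord_symm, abs_of_pos h0]
    by_cases h1 : p.1 < 1
    · rw [Set.indicator_of_mem (by rwa [mem_ball_zero_iff, hn]),
        Set.indicator_of_mem (show p ∈ Set.Ioo (0 : ℝ) 1 ×ˢ Set.Ioo (-Real.pi)
          Real.pi from ⟨⟨h0, h1⟩, hp.2⟩), e]; simp
    · rw [Set.indicator_of_notMem (by rwa [mem_ball_zero_iff, hn]),
        Set.indicator_of_notMem (fun h => h1 h.1.2)]; simp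
  rw [setIntegral_congr_fun polarCoord.open_target.measurableSet key,
    setIntegral_indicator (measurableSet_Ioo.prod measurableSet_Ioo),
    polarCoord_target, Set.prod_inter_prod, Set.inter_self,
    Set.inter_eq_right.2 (fun x hx => hx.1)]
  -- The closed box is the form required by the divergence theorem; it differs from the open one by
  -- a null set.
  refine setIntegral_congr_set ?_
  rw [← Set.Icc_prod_Icc]
  exact Measure.set_prod_ae_eq Ioo_ae_eq_Icc Ioo_ae_eq_Icc

/-- The divergence theorem on the unit disc. -/
theorem setIntegral_disc_divergence {F G : ℂ → ℂ} (hF : ContDiff ℝ 1 F) (hG : ContDiff ℝ 1 G) :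
    ∫ z in disc, (fderiv ℝ F z 1 + fderiv ℝ G z Complex.I) =
      ∫ β in (-Real.pi)..Real.pi,
        (Real.cos β * F (polarPoint 1 β) + Real.sin β * G (polarPoint 1 β)) := by
  -- `f` is `r` times the radial component of the field `(F, G)` and `g` is its angular component,
  -- so that `∂_r f + ∂_β g` is the Jacobian `r` times the divergence.
  set f : ℝ × ℝ → ℂ := fun p => p.1 * (Real.cos p.2 * F (polarPoint p.1 p.2)
    + Real.sin p.2 * G (polarPoint p.1 p.2)) with hf
  set g : ℝ × ℝ → ℂ := fun p => -Real.sin p.2 * F (polarPoint p.1 p.2)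
    + Real.cos p.2 * G (polarPoint p.1 p.2) with hg
  have h := Complex.ofRealCLM.contDiff (n := 1)
  have h1 : ContDiff ℝ 1 fun p : ℝ × ℝ => ((p.1 : ℝ) : ℂ) := h.comp contDiff_fst
  have h2 : ContDiff ℝ 1 fun p : ℝ × ℝ => ((Real.cos p.2 : ℝ) : ℂ) :=
    h.comp (Real.contDiff_cos.comp contDiff_snd)
  have h3 : ContDiff ℝ 1 fun p : ℝ × ℝ => ((Real.sin p.2 : ℝ) : ℂ) :=
    h.comp (Real.contDiff_sin.comp contDiff_snd)
  have hFp := hF.comp contDiff_polarPoint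
  have hGp := hG.comp contDiff_polarPoint
  have hfd : ContDiff ℝ 1 f := h1.mul ((h2.mul hFp).add (h3.mul hGp))
  have hgd : ContDiff ℝ 1 g := (h3.neg.mul hFp).add (h2.mul hGp)
  have hdiv : ∀ p : ℝ × ℝ, fderiv ℝ f p (1, 0) + fderiv ℝ g p (0, 1) =
      p.1 * (fderiv ℝ F (polarPoint p.1 p.2) 1
        + fderiv ℝ G (polarPoint p.1 p.2) Complex.I) := by
    rintro ⟨r, β⟩
    have e1 : fderiv ℝ f (r, β) (1, 0) = 1 * (Real.cos β * F (polarPoint r β)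
        + Real.sin β * G (polarPoint r β)) + r * (Real.cos β * (Real.cos β *
        fderiv ℝ F (polarPoint r β) 1 + Real.sin β * fderiv ℝ F (polarPoint r β) Complex.I)
        + Real.sin β * (Real.cos β * fderiv ℝ G (polarPoint r β) 1
        + Real.sin β * fderiv ℝ G (polarPoint r β) Complex.I)) := by
      have a := (hfd.differentiable one_ne_zero (r, β)).hasFDerivAt.comp_hasDerivAt r
        ((hasDerivAt_id r).prodMk (hasDerivAt_const r β))
      have b := (Complex.ofRealCLM.hasDerivAt (x := r)).mul
        (((hasDerivAt_radial hF r β).const_mul (Real.cos β : ℂ)).add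
          ((hasDerivAt_radial hG r β).const_mul (Real.sin β : ℂ)))
      refine a.unique ?_
      convert! b using 1
    have e2 : fderiv ℝ g (r, β) (0, 1) =
        (-Real.cos β * F (polarPoint r β) + -Real.sin β * (r * (-Real.sin β *
        fderiv ℝ F (polarPoint r β) 1 + Real.cos β * fderiv ℝ F (polarPoint r β) Complex.I)))
        + (-Real.sin β * G (polarPoint r β) + Real.cos β * (r * (-Real.sin β *
        fderiv ℝ G (polarPoint r β) 1
        + Real.cos β * fderiv ℝ G (polarPoint r β) Complex.I))) := by
      have a := (hgd.differentiable one_ne_zero (r, β)).hasFDerivAt.comp_hasDerivAt β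
        ((hasDerivAt_const β r).prodMk (hasDerivAt_id β))
      have b := ((hasDerivAt_ofReal_sin β).neg.mul (hasDerivAt_angular hF r β)).add
        ((hasDerivAt_ofReal_cos β).mul (hasDerivAt_angular hG r β))
      refine a.unique ?_
      convert! b using 1
    rw [e1, e2]
    have hcs : (Real.cos β : ℂ) ^ 2 + (Real.sin β : ℂ) ^ 2 = 1 := by
      exact_mod_cast Real.cos_sq_add_sin_sq β
    dsimp only
    linear_combination (r * (fderiv ℝ F (polarPoint r β) 1
      + fderiv ℝ G (polarPoint r β) Complex.I)) * hcs
  have hFc := hF.continuous_fderiv one_ne_zero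
  have hGc := hG.continuous_fderiv one_ne_zero
  have hle : ((0, -Real.pi) : ℝ × ℝ) ≤ (1, Real.pi) :=
    ⟨zero_le_one, by simpa using Real.pi_pos.le⟩
  have := integral_divergence_prod_Icc_of_hasFDerivAt_of_le f g (fderiv ℝ f) (fderiv ℝ g)
    (0, -Real.pi) (1, Real.pi) hle hfd.continuous.continuousOn hgd.continuous.continuousOn
    (fun x _ => (hfd.differentiable one_ne_zero x).hasFDerivAt)
    (fun x _ => (hgd.differentiable one_ne_zero x).hasFDerivAt) (by
      refine ContinuousOn.integrableOn_compact isCompact_Icc (Continuous.continuousOn ?_)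
      exact ((hfd.continuous_fderiv one_ne_zero).clm_apply continuous_const).add
        ((hgd.continuous_fderiv one_ne_zero).clm_apply continuous_const))
  rw [setIntegral_disc_eq_polar]
  simp_rw [hdiv] at this
  rw [this]
  -- The faces `β = ±π` cancel by periodicity and the face `r = 0` vanishes because of the factor
  -- `r` in `f`; only `r = 1` remains.
  have hper : ∀ x : ℝ, polarPoint x (-Real.pi) = polarPoint x Real.pi := by
    intro x; simp [polarPoint]
  simp [hf, hg, hper]

/-! ### The operators `∂`, `∂̄`, Green's formula and Fourier coefficients -/

/-- The pointwise operator `∂`. -/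
def dz (F : ℂ → ℂ) (z : ℂ) : ℂ := (1 / 2 : ℂ)
    * (fderiv ℝ F z 1 - Complex.I * fderiv ℝ F z Complex.I)

/-- The pointwise operator `∂̄`. -/
def dzbar (F : ℂ → ℂ) (z : ℂ) : ℂ :=
  (1 / 2 : ℂ) * (fderiv ℝ F z 1 + Complex.I * fderiv ℝ F z Complex.I)

/-- The Fourier coefficients of the restriction of `F` to the unit circle. -/
def circleCoeff (F : ℂ → ℂ) (n : ℤ) : ℂ :=
  fourierCoeff (fun β : AddCircle (2 * Real.pi) => F (AddCircle.toCircle β : ℂ)) n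

lemma coe_toCircle_coe (β : ℝ) :
    ((AddCircle.toCircle (β : AddCircle (2 * Real.pi)) : Circle) : ℂ) = polarPoint 1 β := by
  rw [AddCircle.toCircle_apply_mk, polarPoint_eq, div_self Real.two_pi_pos.ne']
  simp

lemma fourier_coe_two_pi (n : ℤ) (β : ℝ) :
    fourier n (β : AddCircle (2 * Real.pi)) = Complex.exp (n * β * Complex.I) := by
  rw [fourier_coe_apply]
  congr 1
  have : (Real.pi : ℂ) ≠ 0 := by exact_mod_cast Real.pi_ne_zero
  push_cast; field_simp

lemma circleCoeff_eq (F : ℂ → ℂ) (n : ℤ) :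
    circleCoeff F n = (1 / (2 * Real.pi)) *
      ∫ β in (-Real.pi)..Real.pi, Complex.exp (-n * β * Complex.I) * F (polarPoint 1 β) := by
  rw [circleCoeff, fourierCoeff_eq_intervalIntegral _ _ (-Real.pi)]
  have : -Real.pi + 2 * Real.pi = Real.pi := by ring
  simp_rw [this, fourier_coe_two_pi, coe_toCircle_coe, smul_eq_mul, Complex.real_smul]
  push_cast
  rfl

lemma pi_mul_circleCoeff (F : ℂ → ℂ) (n : ℤ) :
    Real.pi * circleCoeff F n = (1 / 2) *
      ∫ β in (-Real.pi)..Real.pi, Complex.exp (-n * β * Complex.I) * F (polarPoint 1 β) := by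
  have : (Real.pi : ℂ) ≠ 0 := by exact_mod_cast Real.pi_ne_zero
  rw [circleCoeff_eq, ← mul_assoc]; congr 1; field_simp

lemma fderiv_const_mul_apply {F : ℂ → ℂ} (hF : ContDiff ℝ 1 F) (c z e : ℂ) :
    fderiv ℝ (fun w => c * F w) z e = c * fderiv ℝ F z e := by
  rw [fderiv_const_mul (hF.differentiable one_ne_zero z)]; rfl

lemma fderiv_mul_apply {F G : ℂ → ℂ} (hF : ContDiff ℝ 1 F) (hG : ContDiff ℝ 1 G) (z e : ℂ) :
    fderiv ℝ (fun w => F w * G w) z e = F z * fderiv ℝ G z e + fderiv ℝ F z e * G z := by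
  rw [fderiv_fun_mul (hF.differentiable one_ne_zero z) (hG.differentiable one_ne_zero z)]
  simp [mul_comm]

lemma fderiv_conj_apply {F : ℂ → ℂ} (hF : ContDiff ℝ 1 F) (z e : ℂ) :
    fderiv ℝ (fun w => conj (F w)) z e = conj (fderiv ℝ F z e) := by
  have := (Complex.conjCLE.toContinuousLinearMap.hasFDerivAt (x := F z)).comp z
    (hF.differentiable one_ne_zero z).hasFDerivAt
  exact congrArg (fun L : ℂ →L[ℝ] ℂ => L e) this.fderiv

lemma contDiff_conj {n : WithTop ℕ∞} {F : ℂ → ℂ} (hF : ContDiff ℝ n F) :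
    ContDiff ℝ n fun w => conj (F w) :=
  Complex.conjCLE.contDiff.comp hF

lemma dz_mul {F G : ℂ → ℂ} (hF : ContDiff ℝ 1 F) (hG : ContDiff ℝ 1 G) (z : ℂ) :
    dz (fun w => F w * G w) z = F z * dz G z + dz F z * G z := by
  simp only [dz, fderiv_mul_apply hF hG]; ring

lemma dz_conj {F : ℂ → ℂ} (hF : ContDiff ℝ 1 F) (z : ℂ) :
    dz (fun w => conj (F w)) z = conj (dzbar F z) := by
  simp only [dz, dzbar, fderiv_conj_apply hF]; simp [Complex.ext_iff, sub_eq_add_neg]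

lemma fderiv_pow_apply (n : ℕ) (z e : ℂ) :
    fderiv ℝ (fun w : ℂ => w ^ n) z e = n * z ^ (n - 1) * e := by
  have := (hasDerivAt_pow n z).hasFDerivAt.restrictScalars ℝ
  rw [this.fderiv]; simp [mul_comm]

lemma contDiff_pow (n : ℕ) {m : WithTop ℕ∞} : ContDiff ℝ m fun w : ℂ => w ^ n := contDiff_id.pow n

lemma dz_pow (n : ℕ) (z : ℂ) : dz (fun w => w ^ n) z = n * z ^ (n - 1) := by
  simp only [dz, fderiv_pow_apply]
  linear_combination (-1/2) * (n * z ^ (n - 1)) * Complex.I_sq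

lemma dzbar_pow (n : ℕ) (z : ℂ) : dzbar (fun w => w ^ n) z = 0 := by
  simp only [dzbar, fderiv_pow_apply]
  linear_combination (1/2) * (n * z ^ (n - 1)) * Complex.I_sq

/-- Green's formula for `∂` on the unit disc. -/
theorem setIntegral_dz {F : ℂ → ℂ} (hF : ContDiff ℝ 1 F) :
    ∫ z in disc, dz F z = Real.pi * circleCoeff F 1 := by
  -- The field `(F/2, -iF/2)` has divergence `∂F` and normal component `e^{-iβ} F / 2`, whence the
  -- mode of index `1`.
  have h := setIntegral_disc_divergence (contDiff_const.mul hF : ContDiff ℝ 1 fun w => (1 / 2 : ℂ)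
      * F w)
    (contDiff_const.mul hF : ContDiff ℝ 1 fun w => (-Complex.I / 2 : ℂ) * F w)
  simp_rw [fderiv_const_mul_apply hF] at h
  rw [pi_mul_circleCoeff, ← intervalIntegral.integral_const_mul]
  refine (integral_congr_ae (ae_of_all _ fun z => ?_)).trans (h.trans
    (intervalIntegral.integral_congr fun β _ => ?_))
  · simp only [dz]; ring
  · have : Complex.exp (-((1 : ℤ) : ℂ) * β * Complex.I) = Real.cos β - Real.sin β * Complex.I := by
      rw [show -((1 : ℤ) : ℂ) * β * Complex.I = (-β : ℂ) * Complex.I by push_cast; ring,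
        Complex.exp_mul_I, Complex.cos_neg, Complex.sin_neg, Complex.ofReal_cos, Complex.ofReal_sin]
      ring
    simp only [this]; ring

lemma continuous_toCircle_coe :
    Continuous fun β : AddCircle (2 * Real.pi) => (AddCircle.toCircle β : ℂ) :=
  continuous_subtype_val.comp AddCircle.continuous_toCircle

lemma coe_toCircle_zpow (n : ℤ) (β : AddCircle (2 * Real.pi)) :
    ((AddCircle.toCircle β : Circle) : ℂ) ^ n = fourier n β := by
  rw [fourier_apply, AddCircle.toCircle_zsmul, Circle.coe_zpow]

lemma conj_coe_toCircle (β : AddCircle (2 * Real.pi)) :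
    conj ((AddCircle.toCircle β : Circle) : ℂ) = ((AddCircle.toCircle β : Circle) : ℂ)⁻¹ := by
  rw [← Circle.coe_inv_eq_conj, Circle.coe_inv]

lemma coe_toCircle_ne_zero (β : AddCircle (2 * Real.pi)) :
    ((AddCircle.toCircle β : Circle) : ℂ) ≠ 0 := Circle.coe_ne_zero _

lemma circleCoeff_conj_pow_mul (k : ℕ) (F : ℂ → ℂ) :
    circleCoeff (fun z => conj (z ^ k) * F z) 1 = circleCoeff F (k + 1) := by
  unfold circleCoeff fourierCoeff
  congr 1; ext β
  dsimp only
  rw [map_pow, conj_coe_toCircle, ← coe_toCircle_zpow, ← coe_toCircle_zpow, smul_eq_mul,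
    smul_eq_mul,
    ← mul_assoc, inv_pow, ← zpow_natCast, ← zpow_neg, ← zpow_add₀ (coe_toCircle_ne_zero β)]
  congr 3; ring

lemma circleCoeff_id_mul (F : ℂ → ℂ) :
    circleCoeff (fun z => z * F z) 1 = circleCoeff F 0 := by
  unfold circleCoeff fourierCoeff
  congr 1; ext β
  rw [← coe_toCircle_zpow, ← coe_toCircle_zpow, smul_eq_mul, smul_eq_mul, ← mul_assoc,
    ← zpow_add_one₀ (coe_toCircle_ne_zero β)]
  simp

lemma circleCoeff_conj (F : ℂ → ℂ) (n : ℤ) :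
    circleCoeff (fun z => conj (F z)) n = conj (circleCoeff F (-n)) := by
  unfold circleCoeff fourierCoeff
  rw [← integral_conj]
  congr 1; ext β
  rw [smul_eq_mul, smul_eq_mul, map_mul, neg_neg, ← fourier_neg]

lemma circleCoeff_pow (k : ℕ) (n : ℤ) :
    circleCoeff (fun z => z ^ k) n = if n = k then 1 else 0 := by
  have := fourierCoeff_fourier (T := 2 * Real.pi) (k : ℤ)
  unfold circleCoeff
  simp_rw [← zpow_natCast, coe_toCircle_zpow]
  rw [this, Pi.single_apply]

/-! ### Monomials in `L²(Ω)` and Bessel's inequality -/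

/-- The class in `L²(Ω)` of a function that is continuous on the whole plane. -/
def discLp (F : ℂ → ℂ) (hF : Continuous F) : L2 disc :=
  MemLp.toLp F (by
    obtain ⟨C, hC⟩ := (isCompact_closedBall (0 : ℂ) 1).exists_bound_of_continuousOn hF.continuousOn
    have : IsFiniteMeasure ((volume : Measure ℂ).restrict disc) :=
      ⟨by rw [Measure.restrict_apply_univ]; exact measure_ball_lt_top⟩
    refine MemLp.of_bound hF.aestronglyMeasurable C ?_
    refine (ae_restrict_iff' Metric.isOpen_ball.measurableSet).2 (ae_of_all _ fun z hz => ?_)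
    exact hC z (Metric.ball_subset_closedBall hz))

lemma coeFn_discLp {F : ℂ → ℂ} (hF : Continuous F) :
    discLp F hF =ᵐ[volume.restrict disc] F := MemLp.coeFn_toLp _

lemma inner_discLp {F G : ℂ → ℂ} (hF : Continuous F) (hG : Continuous G) :
    inner ℂ (discLp F hF) (discLp G hG) = ∫ z in disc, conj (F z) * G z := by
  rw [L2.inner_def]
  refine integral_congr_ae ?_
  filter_upwards [coeFn_discLp hF, coeFn_discLp hG] with z h1 h2
  rw [h1, h2, RCLike.inner_apply, mul_comm]

/-- The class in `L²(Γ)` of the restriction to the circle of a continuous function. -/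
def circLp (F : ℂ → ℂ) (hF : Continuous F) : L2Circle :=
  ContinuousMap.toLp 2 AddCircle.haarAddCircle ℂ
    ⟨fun β : AddCircle (2 * Real.pi) => F (AddCircle.toCircle β : ℂ),
      hF.comp continuous_toCircle_coe⟩

lemma coeFn_circLp {F : ℂ → ℂ} (hF : Continuous F) :
    circLp F hF =ᵐ[AddCircle.haarAddCircle] fun β => F (AddCircle.toCircle β : ℂ) :=
  ContinuousMap.coeFn_toLp _ _

lemma fourierCoeff_circLp {F : ℂ → ℂ} (hF : Continuous F) (n : ℤ) :
    fourierCoeff (circLp F hF) n = circleCoeff F n := fourierCoeff_toLp _ _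

lemma continuous_fderiv_apply {F : ℂ → ℂ} (hF : ContDiff ℝ 1 F) (e : ℂ) :
    Continuous fun z => fderiv ℝ F z e :=
  (hF.continuous_fderiv one_ne_zero).clm_apply continuous_const

lemma continuous_dz {F : ℂ → ℂ} (hF : ContDiff ℝ 1 F) : Continuous (dz F) :=
  continuous_const.mul ((continuous_fderiv_apply hF 1).sub
    (continuous_const.mul (continuous_fderiv_apply hF Complex.I)))

lemma continuous_dzbar {F : ℂ → ℂ} (hF : ContDiff ℝ 1 F) : Continuous (dzbar F) :=
  continuous_const.mul ((continuous_fderiv_apply hF 1).add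
    (continuous_const.mul (continuous_fderiv_apply hF Complex.I)))

/-- The conjugate of `z^k` is annihilated by `∂`, so the integrand is `∂(conj(z^k) F)` and Green's
formula applies; on the circle `conj z = z⁻¹` shifts the mode `1` to `k + 1`. -/
lemma inner_pow_dz (k : ℕ) {F : ℂ → ℂ} (hF : ContDiff ℝ 1 F) :
    inner ℂ (discLp (fun z => z ^ k) (continuous_pow k)) (discLp (dz F) (continuous_dz hF)) =
      Real.pi * circleCoeff F (k + 1) := by
  rw [inner_discLp, ← circleCoeff_conj_pow_mul,
    ← setIntegral_dz ((contDiff_conj (contDiff_pow k)).mul hF)]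
  congr 1; ext z
  rw [dz_mul (contDiff_conj (contDiff_pow k)) hF, dz_conj (contDiff_pow k), dzbar_pow]
  simp

/-- This is `inner_pow_dz` for `F = z^(l+1)`, whose `∂` is `(l+1) z^l` and whose only boundary mode
is `l + 1`. -/
lemma inner_pow_pow (k l : ℕ) :
    inner ℂ (discLp (fun z => z ^ k) (continuous_pow k)) (discLp (fun z => z ^ l)
      (continuous_pow l)) =
      if k = l then (Real.pi / (l + 1) : ℂ) else 0 := by
  have hl : (l + 1 : ℂ) ≠ 0 := by exact_mod_cast Nat.succ_ne_zero l
  have e : discLp (dz fun z => z ^ (l + 1)) (continuous_dz (contDiff_pow _)) =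
      (l + 1 : ℂ) • discLp (fun z => z ^ l) (continuous_pow l) := by
    refine Lp.ext ?_
    filter_upwards [coeFn_discLp (continuous_dz (contDiff_pow (l + 1))),
      coeFn_discLp (continuous_pow l), Lp.coeFn_smul (l + 1 : ℂ) (discLp _ (continuous_pow l))]
      with z h1 h2 h3
    rw [h1, h3, Pi.smul_apply, h2, dz_pow]; simp
  have := inner_pow_dz k (contDiff_pow (l + 1) (m := 1))
  rw [e, inner_smul_right, circleCoeff_pow] at this
  have hkl : ((k : ℤ) + 1 = ((l + 1 : ℕ) : ℤ)) ↔ k = l := by push_cast; omega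
  simp only [hkl] at this
  split_ifs at this ⊢ with h
  · rw [eq_div_iff hl, mul_comm, this, mul_one]
  · simpa [hl] using this

/-- The normalized monomials, an orthonormal system of `L²(Ω)`. -/
def monomialLp (k : ℕ) : L2 disc :=
  (Real.sqrt ((k + 1) / Real.pi) : ℂ) • discLp (fun z => z ^ k) (continuous_pow k)

lemma orthonormal_monomialLp : Orthonormal ℂ monomialLp := by
  rw [orthonormal_iff_ite]
  intro k l
  rw [monomialLp, monomialLp, inner_smul_left, inner_smul_right, inner_pow_pow]
  split_ifs with h
  · subst h
    have h0 : (0 : ℝ) ≤ (k + 1) / Real.pi := by positivity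
    have hl : (k + 1 : ℂ) ≠ 0 := by exact_mod_cast Nat.succ_ne_zero k
    have : (Real.pi : ℂ) ≠ 0 := by exact_mod_cast Real.pi_ne_zero
    rw [Complex.conj_ofReal, ← mul_assoc, ← Complex.ofReal_mul, Real.mul_self_sqrt h0]
    push_cast; field_simp
  · simp

lemma norm_inner_monomialLp (k : ℕ) {F : ℂ → ℂ} (hF : ContDiff ℝ 1 F) :
    ‖inner ℂ (monomialLp k) (discLp (dz F) (continuous_dz hF))‖ ^ 2 =
      Real.pi * (k + 1) * ‖circleCoeff F (k + 1)‖ ^ 2 := by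
  rw [monomialLp, inner_smul_left, inner_pow_dz k hF]
  have h0 : (0 : ℝ) ≤ (k + 1) / Real.pi := by positivity
  have := Real.pi_pos
  rw [norm_mul, mul_pow, Complex.conj_ofReal, Complex.norm_real, norm_mul, mul_pow,
    Complex.norm_real,
    Real.norm_of_nonneg (Real.sqrt_nonneg _), Real.sq_sqrt h0, Real.norm_of_nonneg this.le]
  field_simp

/-- Bessel's inequality for the monomials: the positive Fourier modes of the boundary values are
controlled by `∂`. -/
lemma tsum_circleCoeff_pos_le {F : ℂ → ℂ} (hF : ContDiff ℝ 1 F) :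
    ∑' k : ℕ, ENNReal.ofReal (Real.pi * (k + 1)) * ‖circleCoeff F (k + 1)‖ₑ ^ 2 ≤
      ‖discLp (dz F) (continuous_dz hF)‖ₑ ^ 2 := by
  have h1 := orthonormal_monomialLp.tsum_inner_products_le (discLp (dz F) (continuous_dz hF))
  have h2 := orthonormal_monomialLp.inner_products_summable (discLp (dz F) (continuous_dz hF))
  simp_rw [norm_inner_monomialLp _ hF] at h1 h2
  have h3 := ENNReal.ofReal_le_ofReal h1
  rw [ENNReal.ofReal_tsum_of_nonneg (fun k => by have := Real.pi_pos; positivity) h2,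
    ENNReal.ofReal_pow (norm_nonneg _), ofReal_norm] at h3
  refine le_of_eq_of_le (tsum_congr fun k => ?_) h3
  rw [ENNReal.ofReal_mul (p := Real.pi * (k + 1)) (by have := Real.pi_pos; positivity),
    ENNReal.ofReal_pow (norm_nonneg _),
    ofReal_norm]

lemma norm_discLp_conj {F : ℂ → ℂ} (hF : Continuous F) (hF' : Continuous fun z => conj (F z)) :
    ‖discLp (fun z => conj (F z)) hF'‖ₑ = ‖discLp F hF‖ₑ := by
  rw [discLp, discLp, Lp.enorm_toLp, Lp.enorm_toLp]
  exact eLpNorm_congr_norm_ae (ae_of_all _ fun z => RCLike.norm_conj _)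

/-- Conjugation exchanges `∂` with `∂̄` and reverses the frequencies, so this follows from the
positive modes of `conj F`. -/
lemma tsum_circleCoeff_neg_le {F : ℂ → ℂ} (hF : ContDiff ℝ 1 F) :
    ∑' k : ℕ, ENNReal.ofReal (Real.pi * (k + 1)) * ‖circleCoeff F (-(k + 1))‖ₑ ^ 2 ≤
      ‖discLp (dzbar F) (continuous_dzbar hF)‖ₑ ^ 2 := by
  have := tsum_circleCoeff_pos_le (contDiff_conj hF)
  simp_rw [circleCoeff_conj, RCLike.enorm_conj] at this
  refine this.trans_eq ?_
  have e : (dz fun w => conj (F w)) = fun z => conj (dzbar F z) := funext fun z => dz_conj hF z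
  rw [← norm_discLp_conj (continuous_dzbar hF) (Complex.continuous_conj.comp (continuous_dzbar hF))]
  simp only [e]

/-! ### The energy identity -/

/-- The tangential derivative. -/
def tang (F : ℂ → ℂ) (z : ℂ) : ℂ := fderiv ℝ F z (Complex.I * z)

lemma hasDerivAt_circle {F : ℂ → ℂ} (hF : ContDiff ℝ 1 F) (β : ℝ) :
    HasDerivAt (fun t : ℝ => F (polarPoint 1 t)) (tang F (polarPoint 1 β)) β := by
  have h := hasDerivAt_angular hF 1 β
  have e : Complex.I * polarPoint 1 β = ((-Real.sin β : ℝ) : ℂ) + (Real.cos β : ℝ) * Complex.I := by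
    simp only [polarPoint]; push_cast
    linear_combination (Complex.sin β) * Complex.I_sq
  rw [tang, e, clm_apply_eq]
  simpa using h

lemma continuous_tang {F : ℂ → ℂ} (hF : ContDiff ℝ 1 F) : Continuous (tang F) :=
  (hF.continuous_fderiv one_ne_zero).clm_apply (continuous_const.mul continuous_id)

/-- Integration by parts over a full period, where the boundary terms cancel. -/
lemma circleCoeff_tang {F : ℂ → ℂ} (hF : ContDiff ℝ 1 F) (n : ℤ) :
    circleCoeff (tang F) n = Complex.I * n * circleCoeff F n := by
  rw [circleCoeff_eq, circleCoeff_eq]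
  have hd : ∀ β : ℝ, HasDerivAt (fun t : ℝ => Complex.exp (-n * t * Complex.I))
      (-n * Complex.I * Complex.exp (-n * β * Complex.I)) β := by
    intro β
    have h1 : HasDerivAt (fun t : ℝ => (-n * t * Complex.I : ℂ)) (-n * Complex.I) β := by
      simpa using ((Complex.ofRealCLM.hasDerivAt (x := β)).const_mul (-n : ℂ)).mul_const Complex.I
    rw [mul_comm]
    exact h1.cexp
  have hc : Continuous fun β : ℝ => polarPoint 1 β := by
    exact continuous_polarPoint.comp (Continuous.prodMk_right (1 : ℝ))
  rw [intervalIntegral.integral_mul_deriv_eq_deriv_mul (fun x _ => hd x)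
    (fun x _ => hasDerivAt_circle hF x)
    (Continuous.intervalIntegrable (by fun_prop) _ _)
    (((continuous_tang hF).comp hc).intervalIntegrable _ _)]
  have hper : polarPoint 1 (-Real.pi) = polarPoint 1 Real.pi := by simp [polarPoint]
  have hexp : Complex.exp (-n * (-Real.pi : ℝ) * Complex.I)
      = Complex.exp (-n * Real.pi * Complex.I) := by
    have := (Complex.exp_periodic.int_mul n) (-n * Real.pi * Complex.I)
    rw [← this]; congr 1; push_cast; ring
  rw [hper, hexp, sub_self, zero_sub]
  simp_rw [mul_assoc]
  rw [intervalIntegral.integral_const_mul, intervalIntegral.integral_const_mul]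
  ring

/-- Parseval's formula for continuous functions on the circle. -/
lemma hasSum_circleCoeff {F G : ℂ → ℂ} (hF : Continuous F) (hG : Continuous G) :
    HasSum (fun n => conj (circleCoeff F n) * circleCoeff G n)
      (circleCoeff (fun z => conj (F z) * G z) 0) := by
  have h := (fourierBasis (T := 2 * Real.pi)).hasSum_inner_mul_inner (circLp F hF) (circLp G hG)
  simp_rw [← inner_conj_symm (circLp F hF), ← HilbertBasis.repr_apply_apply, fourierBasis_repr,
    fourierCoeff_circLp] at h
  convert! h using 1
  rw [inner_conj_symm, L2.inner_def, circleCoeff, fourierCoeff]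
  refine integral_congr_ae ?_
  filter_upwards [coeFn_circLp hF, coeFn_circLp hG] with z h1 h2
  rw [h1, h2, RCLike.inner_apply]; simp [mul_comm]

lemma fderiv_fderiv_comm {F : ℂ → ℂ} (hF : ContDiff ℝ 2 F) (z a b : ℂ) :
    fderiv ℝ (fun w => fderiv ℝ F w a) z b = fderiv ℝ (fun w => fderiv ℝ F w b) z a := by
  have hd : DifferentiableAt ℝ (fderiv ℝ F) z :=
    (hF.fderiv_right (m := 1) (by norm_num)).differentiable one_ne_zero z
  have h (a b : ℂ) : fderiv ℝ (fun w => fderiv ℝ F w a) z b = fderiv ℝ (fderiv ℝ F) z b a := by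
    rw [fderiv_clm_apply hd (differentiableAt_const a)]; simp
  rw [h, h]
  exact second_derivative_symmetric
    (fun y => (hF.differentiable two_ne_zero y).hasFDerivAt) hd.hasFDerivAt b a

/-- The difference of the Dirichlet energies of `∂` and `∂̄` is a boundary term. -/
theorem setIntegral_dz_sub_dzbar {F : ℂ → ℂ} (hF : ContDiff ℝ 2 F) :
    ∫ z in disc, (conj (dz F z) * dz F z - conj (dzbar F z) * dzbar F z) =
      Real.pi * ∑' n : ℤ, (n : ℂ) * ‖circleCoeff F n‖ ^ 2 := by
  have hF1 : ContDiff ℝ 1 F := hF.of_le (by norm_num)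
  have hd (e : ℂ) : ContDiff ℝ 1 fun z => fderiv ℝ F z e :=
    (hF.fderiv_right (m := 1) (by norm_num)).clm_apply contDiff_const
  -- With `c = -(i/2) conj F`, the field is `(c F_y, -c F_x)`: in its divergence the mixed second
  -- derivatives cancel and `|∂F|² - |∂̄F|²` remains, while on the circle its normal component is
  -- `c` times the tangential derivative of `F`.
  have hc : ContDiff ℝ 1 fun z => -Complex.I / 2 * conj (F z) :=
    contDiff_const.mul (contDiff_conj hF1)
  have h := setIntegral_disc_divergence (hc.mul (hd Complex.I)) (hc.neg.mul (hd 1))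
  have e1 : ∀ z, conj (dz F z) * dz F z - conj (dzbar F z) * dzbar F z =
      fderiv ℝ (fun z => -Complex.I / 2 * conj (F z) * fderiv ℝ F z Complex.I) z 1 +
      fderiv ℝ (fun z => -(-Complex.I / 2 * conj (F z)) * fderiv ℝ F z 1) z Complex.I := by
    intro z
    rw [fderiv_mul_apply hc (hd _), fderiv_mul_apply hc.neg (hd _),
      fderiv_fderiv_comm hF z 1 Complex.I,
      fderiv_fun_neg, neg_apply, fderiv_const_mul_apply (contDiff_conj hF1),
      fderiv_const_mul_apply (contDiff_conj hF1), fderiv_conj_apply hF1, fderiv_conj_apply hF1]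
    simp only [dz, dzbar, map_mul, map_sub, map_add, Complex.conj_I, map_div₀, map_one, map_ofNat]
    ring
  simp_rw [e1, h]
  have hp := hasSum_circleCoeff hF1.continuous (continuous_tang hF1)
  have e2 : ∀ n : ℤ, conj (circleCoeff F n) * circleCoeff (tang F) n =
      Complex.I * ((n : ℂ) * ‖circleCoeff F n‖ ^ 2) := by
    intro n
    rw [circleCoeff_tang hF1, ← Complex.conj_mul']; ring
  simp_rw [e2] at hp
  have e3 := hp.tsum_eq
  rw [tsum_mul_left] at e3
  have e4 : ∑' n : ℤ, (n : ℂ) * ‖circleCoeff F n‖ ^ 2 =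
      -Complex.I * circleCoeff (fun z => conj (F z) * tang F z) 0 := by
    rw [← e3, ← mul_assoc]; simp
  rw [e4, mul_left_comm, pi_mul_circleCoeff, ← mul_assoc, ← intervalIntegral.integral_const_mul]
  refine intervalIntegral.integral_congr fun β _ => ?_
  have hu := (hasDerivAt_circle hF1 β).unique (hasDerivAt_angular hF1 1 β)
  simp only [hu]
  simp
  ring

/-! ### The trace inequality for smooth functions -/

lemma ennreal_add_sq_le (a b : ℝ≥0∞) : (a + b) ^ 2 ≤ 2 * (a ^ 2 + b ^ 2) := by
  have h := ENNReal.rpow_add_le_mul_rpow_add_rpow a b (p := 2) (by norm_num)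
  norm_num at h
  exact_mod_cast h

lemma discLp_sub {F G : ℂ → ℂ} (hF : Continuous F) (hG : Continuous G) :
    discLp (fun z => F z - G z) (hF.sub hG) = discLp F hF - discLp G hG :=
  MemLp.toLp_sub _ _

lemma circLp_sub {F G : ℂ → ℂ} (hF : Continuous F) (hG : Continuous G) :
    circLp (fun z => F z - G z) (hF.sub hG) = circLp F hF - circLp G hG := by
  unfold circLp
  rw [← map_sub]
  rfl

lemma fderiv_sub_apply {F G : ℂ → ℂ} (hF : ContDiff ℝ 1 F) (hG : ContDiff ℝ 1 G) (z e : ℂ) :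
    fderiv ℝ (fun w => F w - G w) z e = fderiv ℝ F z e - fderiv ℝ G z e := by
  rw [fderiv_fun_sub (hF.differentiable one_ne_zero z) (hG.differentiable one_ne_zero z)]; rfl

lemma discLp_dz {F : ℂ → ℂ} (hF : ContDiff ℝ 1 F) :
    discLp (dz F) (continuous_dz hF) = (1 / 2 : ℂ) •
      (discLp (fun z => fderiv ℝ F z 1) (continuous_fderiv_apply hF 1) -
        Complex.I • discLp (fun z => fderiv ℝ F z Complex.I)
          (continuous_fderiv_apply hF Complex.I)) :=
  rfl

lemma discLp_dzbar {F : ℂ → ℂ} (hF : ContDiff ℝ 1 F) :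
    discLp (dzbar F) (continuous_dzbar hF) = (1 / 2 : ℂ) •
      (discLp (fun z => fderiv ℝ F z 1) (continuous_fderiv_apply hF 1) +
        Complex.I • discLp (fun z => fderiv ℝ F z Complex.I)
          (continuous_fderiv_apply hF Complex.I)) :=
  rfl

lemma enorm_half_smul_sq_le {E : Type*} [NormedAddCommGroup E] [NormedSpace ℂ E] {x y w : E}
    (hw : ‖w‖ₑ ≤ ‖x‖ₑ + ‖y‖ₑ) : ‖(1 / 2 : ℂ) • w‖ₑ ^ 2 ≤ ‖x‖ₑ ^ 2 + ‖y‖ₑ ^ 2 := by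
  have h2 : ‖(1 / 2 : ℂ)‖ₑ = 2⁻¹ := by
    rw [← ofReal_norm]; norm_num; rw [one_div, ENNReal.ofReal_inv_of_pos two_pos]; simp
  rw [enorm_smul, mul_pow, h2]
  calc (2⁻¹ : ℝ≥0∞) ^ 2 * ‖w‖ₑ ^ 2 ≤ 2⁻¹ ^ 2 * (2 * (‖x‖ₑ ^ 2 + ‖y‖ₑ ^ 2)) := by
        gcongr
        exact (pow_le_pow_left' hw 2).trans (ennreal_add_sq_le _ _)
    _ = 2⁻¹ * (2⁻¹ * 2) * (‖x‖ₑ ^ 2 + ‖y‖ₑ ^ 2) := by ring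
    _ ≤ 1 * (‖x‖ₑ ^ 2 + ‖y‖ₑ ^ 2) := by
        gcongr
        rw [ENNReal.inv_mul_cancel (by norm_num) (by norm_num)]; simp
    _ = _ := one_mul _

lemma enorm_I_smul {E : Type*} [NormedAddCommGroup E] [NormedSpace ℂ E] (y : E) :
    ‖Complex.I • y‖ₑ = ‖y‖ₑ := by
  rw [enorm_smul, ← ofReal_norm, Complex.norm_I]; simp

lemma enorm_half_sub_sq_le {E : Type*} [NormedAddCommGroup E] [NormedSpace ℂ E] (x y : E) :
    ‖(1 / 2 : ℂ) • (x - Complex.I • y)‖ₑ ^ 2 ≤ ‖x‖ₑ ^ 2 + ‖y‖ₑ ^ 2 :=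
  enorm_half_smul_sq_le (enorm_sub_le.trans_eq (by rw [enorm_I_smul]))

lemma enorm_half_add_sq_le {E : Type*} [NormedAddCommGroup E] [NormedSpace ℂ E] (x y : E) :
    ‖(1 / 2 : ℂ) • (x + Complex.I • y)‖ₑ ^ 2 ≤ ‖x‖ₑ ^ 2 + ‖y‖ₑ ^ 2 :=
  enorm_half_smul_sq_le ((enorm_add_le _ _).trans_eq (by rw [enorm_I_smul]))

/-- The squared `H¹(Ω)` norm of a smooth function. -/
def smoothNormSq {F : ℂ → ℂ} (hF : ContDiff ℝ 1 F) : ℝ≥0∞ :=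
  ‖discLp F hF.continuous‖ₑ ^ 2
    + ‖discLp (fun z => fderiv ℝ F z 1) (continuous_fderiv_apply hF 1)‖ₑ ^ 2
    + ‖discLp (fun z => fderiv ℝ F z Complex.I) (continuous_fderiv_apply hF Complex.I)‖ₑ ^ 2

lemma enorm_dz_sq_le {F : ℂ → ℂ} (hF : ContDiff ℝ 1 F) :
    ‖discLp (dz F) (continuous_dz hF)‖ₑ ^ 2 ≤ smoothNormSq hF := by
  rw [discLp_dz hF, smoothNormSq, add_assoc]
  exact (enorm_half_sub_sq_le _ _).trans le_add_self

lemma enorm_dzbar_sq_le {F : ℂ → ℂ} (hF : ContDiff ℝ 1 F) :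
    ‖discLp (dzbar F) (continuous_dzbar hF)‖ₑ ^ 2 ≤ smoothNormSq hF := by
  rw [discLp_dzbar hF, smoothNormSq, add_assoc]
  exact (enorm_half_add_sq_le _ _).trans le_add_self

lemma integrable_conj_mul {F G : ℂ → ℂ} (hF : Continuous F) (hG : Continuous G) :
    Integrable (fun z => conj (F z) * G z) (volume.restrict disc) := by
  refine (L2.integrable_inner (𝕜 := ℂ) (discLp F hF) (discLp G hG)).congr ?_
  filter_upwards [coeFn_discLp hF, coeFn_discLp hG] with z h1 h2
  rw [h1, h2, RCLike.inner_apply, mul_comm]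

/-- Green's formula for `zF` gives `π F_0 = ∫ F + ∫ z ∂F`, and Cauchy–Schwarz bounds both integrals.
Bessel's inequality does not reach this mode, so the function itself must enter. -/
lemma exists_circleCoeff_zero_le : ∃ C : ℝ≥0∞, C ≠ ⊤ ∧ ∀ (F : ℂ → ℂ) (hF : ContDiff ℝ 1 F),
    ‖circleCoeff F 0‖ₑ ^ 2 ≤ C * smoothNormSq hF := by
  set a := discLp (fun _ => (1 : ℂ)) continuous_const
  set b := discLp (fun z => conj z) Complex.continuous_conj
  refine ⟨2 * (‖a‖ₑ ^ 2 + ‖b‖ₑ ^ 2), by finiteness, fun F hF => ?_⟩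
  have h : (Real.pi : ℂ) * circleCoeff F 0 = inner ℂ a (discLp F hF.continuous)
      + inner ℂ b (discLp (dz F) (continuous_dz hF)) := by
    rw [← circleCoeff_id_mul, ← setIntegral_dz (show ContDiff ℝ 1 fun w => w * F w from
      contDiff_id.mul hF), inner_discLp, inner_discLp,
      ← integral_add (integrable_conj_mul continuous_const hF.continuous)
        (integrable_conj_mul Complex.continuous_conj (continuous_dz hF))]
    congr 1; ext z
    have h1 : dz id z = 1 := by simpa [Function.id_def] using dz_pow 1 z
    have h2 : dz (fun w => w * F w) z = z * dz F z + dz id z * F z := dz_mul contDiff_id hF z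
    change dz (fun w => w * F w) z = _
    rw [h2, h1]
    simp [add_comm]
  have hpi : (1 : ℝ≥0∞) ≤ ‖(Real.pi : ℂ)‖ₑ := by
    rw [← ofReal_norm, Complex.norm_real, Real.norm_of_nonneg Real.pi_pos.le]
    simpa using (by linarith [Real.pi_gt_three] : (1 : ℝ) ≤ Real.pi)
  have hin (x y : L2 disc) : ‖inner ℂ x y‖ₑ ≤ ‖x‖ₑ * ‖y‖ₑ := by
    have := ENNReal.ofReal_le_ofReal (norm_inner_le_norm (𝕜 := ℂ) x y)
    rwa [ENNReal.ofReal_mul (norm_nonneg _), ofReal_norm, ofReal_norm, ofReal_norm] at this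
  have hF0 : ‖discLp F hF.continuous‖ₑ ^ 2 ≤ smoothNormSq hF := by
    rw [smoothNormSq, add_assoc]; exact le_self_add
  calc ‖circleCoeff F 0‖ₑ ^ 2 ≤ ‖(Real.pi : ℂ) * circleCoeff F 0‖ₑ ^ 2 := by
        rw [enorm_mul]; gcongr; exact le_mul_of_one_le_left' hpi
    _ ≤ (‖a‖ₑ * ‖discLp F hF.continuous‖ₑ + ‖b‖ₑ * ‖discLp (dz F) (continuous_dz hF)‖ₑ) ^ 2 := by
        rw [h]; gcongr; exact (enorm_add_le _ _).trans (add_le_add (hin _ _) (hin _ _))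
    _ ≤ 2 * ((‖a‖ₑ * ‖discLp F hF.continuous‖ₑ) ^ 2
          + (‖b‖ₑ * ‖discLp (dz F) (continuous_dz hF)‖ₑ) ^ 2) := ennreal_add_sq_le _ _
    _ ≤ 2 * (‖a‖ₑ ^ 2 * smoothNormSq hF + ‖b‖ₑ ^ 2 * smoothNormSq hF) := by
        rw [mul_pow, mul_pow]; gcongr; exact enorm_dz_sq_le hF
    _ = _ := by ring

/-- Compares the `H^{1/2}` weight at `±(k+1)` with the weight produced by Bessel's inequality, using
`2 ≤ π²`. -/
lemma one_add_sq_rpow_le (k : ℕ) :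
    (1 + ((k : ℝ) + 1) ^ 2) ^ (1 / 2 : ℝ) ≤ Real.pi * (k + 1) := by
  rw [← Real.sqrt_eq_rpow, Real.sqrt_le_left (by have := Real.pi_pos; positivity)]
  have h3 := Real.pi_gt_three
  have hk : (0 : ℝ) ≤ k := k.cast_nonneg
  nlinarith [mul_self_nonneg (Real.pi - 3), sq_nonneg ((k : ℝ) + 1)]

/-- The trace inequality for smooth functions. -/
theorem exists_halfNormSq_circLp_le : ∃ C : ℝ≥0∞, C ≠ ⊤ ∧ ∀ (F : ℂ → ℂ) (hF : ContDiff ℝ 1 F),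
    halfNormSq (circLp F hF.continuous) ≤ C * smoothNormSq hF := by
  obtain ⟨C, hC, h0⟩ := exists_circleCoeff_zero_le
  refine ⟨C + 2, by finiteness, fun F hF => ?_⟩
  rw [halfNormSq]
  simp_rw [fourierCoeff_circLp]
  -- The sum over `ℤ` splits into the zero mode, bounded with constant `C`, and the positive and
  -- negative modes, each bounded with constant `1`.
  rw [tsum_of_nat_of_neg_add_one ENNReal.summable ENNReal.summable,
    tsum_eq_zero_add' ENNReal.summable]
  have hp : ∑' k : ℕ, ENNReal.ofReal ((1 + (((k + 1 : ℕ) : ℤ) : ℝ) ^ 2) ^ (1 / 2 : ℝ)) *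
      ‖circleCoeff F ((k + 1 : ℕ) : ℤ)‖ₑ ^ 2 ≤ smoothNormSq hF := by
    refine le_trans (ENNReal.tsum_le_tsum fun k => ?_)
      ((tsum_circleCoeff_pos_le hF).trans (enorm_dz_sq_le hF))
    have := one_add_sq_rpow_le k
    push_cast
    gcongr
  have hn : ∑' k : ℕ, ENNReal.ofReal ((1 + ((-((k : ℤ) + 1) : ℤ) : ℝ) ^ 2) ^ (1 / 2 : ℝ)) *
      ‖circleCoeff F (-((k : ℤ) + 1))‖ₑ ^ 2 ≤ smoothNormSq hF := by
    refine le_trans (ENNReal.tsum_le_tsum fun k => ?_)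
      ((tsum_circleCoeff_neg_le hF).trans (enorm_dzbar_sq_le hF))
    have := one_add_sq_rpow_le k
    push_cast
    rw [neg_sq]
    gcongr
  have hz : ENNReal.ofReal ((1 + (((0 : ℕ) : ℤ) : ℝ) ^ 2) ^ (1 / 2 : ℝ)) *
      ‖circleCoeff F ((0 : ℕ) : ℤ)‖ₑ ^ 2 ≤ C * smoothNormSq hF := by
    simpa using h0 F hF
  calc _ ≤ C * smoothNormSq hF + smoothNormSq hF + smoothNormSq hF := by gcongr
    _ = _ := by ring

/-! ### The energy inequality for smooth functions -/

lemma one_le_one_add_sq_rpow (k : ℝ) : 1 ≤ (1 + k ^ 2) ^ (1 / 2 : ℝ) :=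
  Real.one_le_rpow (by nlinarith [sq_nonneg k]) (by norm_num)

lemma enorm_sq_eq_tsum (g : L2Circle) : ‖g‖ₑ ^ 2 = ∑' k : ℤ, ‖fourierCoeff g k‖ₑ ^ 2 := by
  have H₁ : HasSum (fun i => ‖fourierBasis.repr g i‖ ^ 2) (‖fourierBasis.repr g‖ ^ 2) := by
    apply_mod_cast lp.hasSum_norm ?_ (fourierBasis.repr g)
    norm_num
  rw [LinearIsometryEquiv.norm_map] at H₁
  simp_rw [fourierBasis_repr] at H₁
  rw [← ofReal_norm, ← ENNReal.ofReal_pow (norm_nonneg _), ← H₁.tsum_eq,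
    ENNReal.ofReal_tsum_of_nonneg (fun _ => by positivity) H₁.summable]
  simp_rw [ENNReal.ofReal_pow (norm_nonneg _), ofReal_norm]

lemma enorm_sq_le_halfNormSq (g : L2Circle) : ‖g‖ₑ ^ 2 ≤ halfNormSq g := by
  rw [enorm_sq_eq_tsum, halfNormSq]
  refine ENNReal.tsum_le_tsum fun k => ?_
  have := ENNReal.ofReal_le_ofReal (one_le_one_add_sq_rpow k)
  rw [ENNReal.ofReal_one] at this
  exact le_mul_of_one_le_left' this

lemma abs_le_one_add_sq_rpow (k : ℝ) : |k| ≤ (1 + k ^ 2) ^ (1 / 2 : ℝ) := by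
  rw [← Real.sqrt_eq_rpow]
  exact Real.abs_le_sqrt (by linarith)

/-- The energy inequality for smooth functions. -/
theorem enorm_dz_sq_le_dzbar {F : ℂ → ℂ} (hF : ContDiff ℝ 2 F) (hF1 : ContDiff ℝ 1 F) :
    ‖discLp (dz F) (continuous_dz hF1)‖ₑ ^ 2 ≤ ‖discLp (dzbar F) (continuous_dzbar hF1)‖ₑ ^ 2 +
      ENNReal.ofReal Real.pi * halfNormSq (circLp F hF1.continuous) := by
  -- The identity has a signed sum, so the comparison takes place in `ℝ`, where the weighted series
  -- must be known to be summable.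
  by_cases htop : halfNormSq (circLp F hF1.continuous) = ⊤
  · rw [htop, ENNReal.mul_top (by simpa using Real.pi_pos)]; simp
  set x := discLp (dz F) (continuous_dz hF1) with hx
  set y := discLp (dzbar F) (continuous_dzbar hF1) with hy
  have h := setIntegral_dz_sub_dzbar hF
  rw [integral_sub (integrable_conj_mul (continuous_dz hF1) (continuous_dz hF1))
      (integrable_conj_mul (continuous_dzbar hF1) (continuous_dzbar hF1)),
    ← inner_discLp (continuous_dz hF1) (continuous_dz hF1),
    ← inner_discLp (continuous_dzbar hF1) (continuous_dzbar hF1), inner_self_eq_norm_sq_to_K,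
    inner_self_eq_norm_sq_to_K, ← hx, ← hy] at h
  have h' : ‖x‖ ^ 2 - ‖y‖ ^ 2 = Real.pi * ∑' n : ℤ, (n : ℝ) * ‖circleCoeff F n‖ ^ 2 := by
    apply Complex.ofReal_injective
    push_cast
    exact h
  set W : ℤ → ℝ := fun n => (1 + (n : ℝ) ^ 2) ^ (1 / 2 : ℝ) * ‖circleCoeff F n‖ ^ 2 with hW
  have hW0 : ∀ n, 0 ≤ W n := fun n => by positivity
  have hWe : ∀ n, ENNReal.ofReal (W n) =
      ENNReal.ofReal ((1 + (n : ℝ) ^ 2) ^ (1 / 2 : ℝ)) * ‖fourierCoeff (circLp F hF1.continuous)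
        n‖ₑ ^ 2 := by
    intro n
    rw [fourierCoeff_circLp, hW, ENNReal.ofReal_mul (by positivity),
      ENNReal.ofReal_pow (norm_nonneg _),
      ofReal_norm]
  have hWs : Summable W := by
    have : ∑' n, ENNReal.ofReal (W n) ≠ ⊤ := by simpa only [hWe, halfNormSq] using htop
    have := ENNReal.summable_toReal this
    simpa only [ENNReal.toReal_ofReal (hW0 _)] using this
  have hhalf : halfNormSq (circLp F hF1.continuous) = ENNReal.ofReal (∑' n, W n) := by
    rw [ENNReal.ofReal_tsum_of_nonneg hW0 hWs, halfNormSq]; simp_rw [hWe]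
  have hle : ∑' n : ℤ, (n : ℝ) * ‖circleCoeff F n‖ ^ 2 ≤ ∑' n, W n := by
    have hb : ∀ n : ℤ, |(n : ℝ)| * ‖circleCoeff F n‖ ^ 2 ≤ W n := fun n => by
      have := abs_le_one_add_sq_rpow n
      simp only [hW]; gcongr
    refine Summable.tsum_le_tsum (fun n => le_trans ?_ (hb n)) ?_ hWs
    · have := le_abs_self (n : ℝ); gcongr
    · refine Summable.of_norm_bounded hWs fun n => ?_
      simpa using hb n
  rw [hhalf, ← ENNReal.ofReal_mul Real.pi_pos.le, ← ofReal_norm, ← ofReal_norm,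
    ← ENNReal.ofReal_pow (norm_nonneg _), ← ENNReal.ofReal_pow (norm_nonneg _),
    ← ENNReal.ofReal_add (by positivity) (mul_nonneg Real.pi_pos.le (tsum_nonneg hW0))]
  refine ENNReal.ofReal_le_ofReal ?_
  have := mul_le_mul_of_nonneg_left hle Real.pi_pos.le
  linarith

/-! ### Triangle inequality for the `H^{1/2}` norm -/

/-- The weighted Fourier coefficients, whose `ℓ²` norm is the `H^{1/2}(Γ)` norm. -/
def weightedCoeff (g : L2Circle) (k : ℤ) : ℂ :=
  ((1 + (k : ℝ) ^ 2) ^ (1 / 4 : ℝ) : ℝ) * fourierCoeff g k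

lemma fourierCoeff_add (g h : L2Circle) (k : ℤ) :
    fourierCoeff (g + h : L2Circle) k = fourierCoeff g k + fourierCoeff h k := by
  simp_rw [← fourierBasis_repr, map_add]; rfl

lemma halfNormSq_eq_eLpNorm (g : L2Circle) :
    halfNormSq g = eLpNorm (weightedCoeff g) 2 Measure.count ^ 2 := by
  have := eLpNorm_nnreal_pow_eq_lintegral (f := weightedCoeff g) (μ := Measure.count) (p := 2)
      two_ne_zero
  have h2 : ((2 : NNReal) : ℝ≥0∞) = 2 := rfl
  have h3 : ((2 : NNReal) : ℝ) = (2 : ℕ) := by norm_num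
  rw [h2, h3, ENNReal.rpow_natCast] at this
  rw [this, lintegral_count, halfNormSq]
  refine tsum_congr fun k => ?_
  rw [ENNReal.rpow_natCast, weightedCoeff, enorm_mul, mul_pow]
  congr 1
  rw [← ofReal_norm, Complex.norm_real, Real.norm_of_nonneg (by positivity),
    ← ENNReal.ofReal_pow (by positivity), ← Real.rpow_mul_natCast (by positivity)]
  norm_num

/-- Minkowski's inequality for the weighted coefficients. It is needed because `halfNormSq` is only
lower semicontinuous on `L²(Γ)`, whereas the energy inequality needs an upper bound along an
approximating sequence. -/
lemma halfNormSq_add_le (g h : L2Circle) {a b : ℝ≥0∞} (ha : halfNormSq g ≤ a ^ 2)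
    (hb : halfNormSq h ≤ b ^ 2) : halfNormSq (g + h) ≤ (a + b) ^ 2 := by
  rw [halfNormSq_eq_eLpNorm] at *
  have e : weightedCoeff (g + h) = weightedCoeff g + weightedCoeff h := by
    ext k; simp only [weightedCoeff, fourierCoeff_add, Pi.add_apply]; ring
  rw [e]
  gcongr
  refine (eLpNorm_add_le (AEStronglyMeasurable.of_discrete) (AEStronglyMeasurable.of_discrete)
    (by norm_num)).trans ?_
  gcongr
  · exact (ENNReal.pow_le_pow_left_iff two_ne_zero).1 ha
  · exact (ENNReal.pow_le_pow_left_iff two_ne_zero).1 hb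

/-! ### Density of smooth functions: mollified dilations -/

lemma eLpNorm_two_sq {α : Type*} [MeasurableSpace α] (μ : Measure α) (f : α → ℂ) :
    eLpNorm f 2 μ ^ 2 = ∫⁻ x, ‖f x‖ₑ ^ 2 ∂μ := by
  have := eLpNorm_nnreal_pow_eq_lintegral (f := f) (μ := μ) (p := 2) two_ne_zero
  have h3 : ((2 : NNReal) : ℝ) = (2 : ℕ) := by norm_num
  simp_rw [h3, ENNReal.rpow_natCast] at this
  exact this

/-- Convolution with a normalized bump function. -/
def mollify (ρ : ContDiffBump (0 : ℂ)) (h : ℂ → ℂ) : ℂ → ℂ :=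
  ρ.normed volume ⋆[ContinuousLinearMap.lsmul ℝ ℝ, volume] h

lemma mollify_apply (ρ : ContDiffBump (0 : ℂ)) (h : ℂ → ℂ) (x : ℂ) :
    mollify ρ h x = ∫ t, ρ.normed volume t • h (x - t) := rfl

lemma contDiff_mollify (ρ : ContDiffBump (0 : ℂ)) {h : ℂ → ℂ} (hh : LocallyIntegrable h) :
    ContDiff ℝ ∞ (mollify ρ h) :=
  ρ.hasCompactSupport_normed.contDiff_convolution_left _ ρ.contDiff_normed hh

lemma mollify_add (ρ : ContDiffBump (0 : ℂ)) {g h : ℂ → ℂ} (hg : LocallyIntegrable g)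
    (hh : LocallyIntegrable h) : mollify ρ (g + h) = mollify ρ g + mollify ρ h :=
  (ρ.hasCompactSupport_normed.convolutionExists_left _ ρ.continuous_normed hg).distrib_add
    (ρ.hasCompactSupport_normed.convolutionExists_left _ ρ.continuous_normed hh)

lemma lintegral_normed (ρ : ContDiffBump (0 : ℂ)) :
    ∫⁻ t, ENNReal.ofReal (ρ.normed volume t) = 1 := by
  rw [← ofReal_integral_eq_lintegral_ofReal ρ.integrable_normed (ae_of_all _ ρ.nonneg_normed),
    ρ.integral_normed, ENNReal.ofReal_one]

/-- Jensen's inequality for the probability density `ρ.normed`, obtained from Cauchy–Schwarz by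
splitting the kernel into two square roots. -/
lemma enorm_mollify_sq_le (ρ : ContDiffBump (0 : ℂ)) {h : ℂ → ℂ} (hh : Measurable h) (x : ℂ) :
    ‖mollify ρ h x‖ₑ ^ 2 ≤ ∫⁻ t, ENNReal.ofReal (ρ.normed volume t) * ‖h (x - t)‖ₑ ^ 2 := by
  set k : ℂ → ℝ≥0∞ := fun t => ENNReal.ofReal (ρ.normed volume t) with hk
  have hkm : Measurable k := ρ.continuous_normed.measurable.ennreal_ofReal
  have hm : Measurable fun t => ‖h (x - t)‖ₑ := (hh.comp (measurable_const.sub measurable_id)).enorm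
  have h1 : ‖mollify ρ h x‖ₑ ≤ ∫⁻ t, (fun t => k t ^ (1 / 2 : ℝ)) t *
      (fun t => k t ^ (1 / 2 : ℝ) * ‖h (x - t)‖ₑ) t := by
    rw [mollify_apply]
    refine (enorm_integral_le_lintegral_enorm _).trans_eq (lintegral_congr fun t => ?_)
    dsimp only
    rw [enorm_smul, ← mul_assoc, ← ENNReal.rpow_add_of_nonneg _ _ (by norm_num) (by norm_num),
      Real.enorm_of_nonneg (ρ.nonneg_normed t)]
    norm_num [hk]
  have h2 := h1.trans (ENNReal.lintegral_mul_le_Lp_mul_Lq volume Real.HolderConjugate.two_two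
    (hkm.pow_const _).aemeasurable ((hkm.pow_const _).mul hm).aemeasurable)
  have e1 : ∀ t, (k t ^ (1 / 2 : ℝ)) ^ (2 : ℝ) = k t := fun t => by
    rw [← ENNReal.rpow_mul]; norm_num
  have e2 : ∀ t, (k t ^ (1 / 2 : ℝ) * ‖h (x - t)‖ₑ) ^ (2 : ℝ) = k t * ‖h (x - t)‖ₑ ^ 2 := fun t =>
      by
    rw [ENNReal.mul_rpow_of_nonneg _ _ (by norm_num), e1]; norm_cast
  simp_rw [e1, e2, hk, lintegral_normed, ENNReal.one_rpow, one_mul] at h2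
  calc ‖mollify ρ h x‖ₑ ^ 2 ≤ _ := pow_le_pow_left' h2 2
    _ = _ := by
      rw [← ENNReal.rpow_natCast, ← ENNReal.rpow_mul]; norm_num

/-- The Jacobian of the dilation contributes `r⁻² ≤ 4`. -/
lemma lintegral_comp_smul_le {r : ℝ} (hr : 1 / 2 ≤ r) {f : ℂ → ℝ≥0∞} (hf : Measurable f) :
    ∫⁻ z, f (r • z) ≤ 4 * ∫⁻ z, f z := by
  have hr0 : 0 < r := by linarith
  rw [← lintegral_map hf (measurable_const_smul r), Measure.map_addHaar_smul _ hr0.ne',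
    lintegral_smul_measure, Complex.finrank_real_complex, smul_eq_mul]
  gcongr
  rw [show (4 : ℝ≥0∞) = ENNReal.ofReal 4 by norm_num]
  refine ENNReal.ofReal_le_ofReal ?_
  rw [abs_of_pos (by positivity), inv_le_comm₀ (by positivity) (by norm_num)]
  nlinarith

/-- Mollified dilations are uniformly bounded on `L²`. -/
lemma eLpNorm_mollify_smul_le (ρ : ContDiffBump (0 : ℂ)) {r : ℝ} (hr : 1 / 2 ≤ r) {h : ℂ → ℂ}
    (hh : Measurable h) (hl : LocallyIntegrable h) :
    eLpNorm (fun z => mollify ρ h (r • z)) 2 volume ≤ 2 * eLpNorm h 2 volume := by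
  rw [← ENNReal.pow_le_pow_left_iff two_ne_zero, mul_pow, eLpNorm_two_sq, eLpNorm_two_sq]
  have hm : Measurable fun z => ‖mollify ρ h z‖ₑ ^ 2 :=
    (contDiff_mollify ρ hl).continuous.measurable.enorm.pow_const 2
  refine (lintegral_comp_smul_le hr hm).trans ?_
  rw [show (2 : ℝ≥0∞) ^ 2 = 4 by norm_num]
  gcongr 4 * ?_
  calc ∫⁻ x, ‖mollify ρ h x‖ₑ ^ 2
      ≤ ∫⁻ x, ∫⁻ t, ENNReal.ofReal (ρ.normed volume t) * ‖h (x - t)‖ₑ ^ 2 :=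
        lintegral_mono (enorm_mollify_sq_le ρ hh)
    _ = ∫⁻ t, ∫⁻ x, ENNReal.ofReal (ρ.normed volume t) * ‖h (x - t)‖ₑ ^ 2 := by
        refine lintegral_lintegral_swap (Measurable.aemeasurable ?_)
        exact (ρ.continuous_normed.measurable.ennreal_ofReal.comp measurable_snd).mul
          ((hh.comp (measurable_fst.sub measurable_snd)).enorm.pow_const 2)
    _ = ∫⁻ t, ENNReal.ofReal (ρ.normed volume t) * ∫⁻ x, ‖h x‖ₑ ^ 2 := by
        refine lintegral_congr fun t => ?_
        have hm' : Measurable fun x => ‖h (x - t)‖ₑ ^ 2 :=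
          (hh.comp (measurable_id.sub_const t)).enorm.pow_const 2
        rw [lintegral_const_mul _ hm',
          lintegral_sub_right_eq_self (fun x => ‖h x‖ₑ ^ 2) t]
    _ = ∫⁻ x, ‖h x‖ₑ ^ 2 := by
        rw [lintegral_mul_const _ ρ.continuous_normed.measurable.ennreal_ofReal, lintegral_normed,
          one_mul]

/-- A sequence of bump functions with supports shrinking to the origin. -/
def bump (k : ℕ) : ContDiffBump (0 : ℂ) where
  rIn := 1 / (k + 2) / 2
  rOut := 1 / (k + 2)
  rIn_pos := by positivity
  rIn_lt_rOut := half_lt_self (by positivity)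

/-- Dilation factors increasing to `1`, adapted to the bump functions. -/
def dil (k : ℕ) : ℝ := 1 - 1 / (k + 2)

lemma bump_rOut (k : ℕ) : (bump k).rOut = 1 - dil k := by simp [bump, dil]

lemma half_le_dil (k : ℕ) : 1 / 2 ≤ dil k := by
  have : (1 : ℝ) / (k + 2) ≤ 1 / 2 := by
    gcongr; have : (0 : ℝ) ≤ k := k.cast_nonneg
    linarith
  unfold dil; linarith

lemma dil_lt_one (k : ℕ) : dil k < 1 := by
  have : (0 : ℝ) < 1 / (k + 2) := by positivity
  unfold dil; linarith

lemma tendsto_dil : Tendsto dil atTop (𝓝 1) := by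
  have : Tendsto (fun k : ℕ => (1 : ℝ) / (k + 2)) atTop (𝓝 0) := by
    have := (tendsto_add_atTop_iff_nat 1).2 (tendsto_one_div_add_atTop_nhds_zero_nat (𝕜 := ℝ))
    refine this.congr fun k => ?_
    push_cast; ring_nf
  have h1 := this.const_sub 1
  rwa [sub_zero] at h1

lemma dist_mollify_le (ρ : ContDiffBump (0 : ℂ)) {g : ℂ → ℂ} (hg : Continuous g) {x z : ℂ} {δ : ℝ}
    (hδ : 0 ≤ δ) (h : ∀ y ∈ Metric.ball x ρ.rOut, dist (g y) z ≤ δ) : dist (mollify ρ g x) z ≤ δ :=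
  dist_convolution_le hδ (ρ.support_normed_eq (μ :=
    volume)).subset ρ.nonneg_normed ρ.integral_normed
    hg.aestronglyMeasurable h

/-- The mollified dilation of a function. -/
def mollDil (k : ℕ) (h : ℂ → ℂ) (z : ℂ) : ℂ := mollify (bump k) h (dil k • z)

lemma tendsto_mollDil_of_continuous {g : ℂ → ℂ} (hg : Continuous g) (hc : HasCompactSupport g) :
    Tendsto (fun k => eLpNorm (mollDil k g - g) 2 volume) atTop (𝓝 0) := by
  obtain ⟨R, hR0, hR⟩ : ∃ R : ℝ, 0 < R ∧ ∀ y, R ≤ ‖y‖ → g y = 0 := by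
    obtain ⟨R, hR⟩ := hc.isCompact.isBounded.subset_ball 0
    refine ⟨max R 1, by positivity, fun y hy => image_eq_zero_of_notMem_tsupport fun h => ?_⟩
    have := hR h
    rw [mem_ball_zero_iff] at this
    exact absurd ((le_max_left R 1).trans hy) (not_le.2 this)
  -- Outside `B` the point `dil k • z` has norm at least `R + 1`, since `dil k ≥ 1/2`, so the
  -- averaging ball of radius at most `1/2` misses the support of `g`. Inside `B` uniform continuity
  -- applies.
  set B := Metric.ball (0 : ℂ) (2 * (R + 1)) with hB
  have hBv : volume B ≠ ⊤ := measure_ball_lt_top.ne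
  have key : ∀ δ : ℝ, 0 < δ → ∀ᶠ k in atTop, ∀ z, ‖mollDil k g z - g z‖ ≤ B.indicator (fun _ => δ)
      z := by
    intro δ hδ
    obtain ⟨η, hη, hu⟩ := Metric.uniformContinuous_iff.1 (hc.uniformContinuous_of_continuous hg)
        δ hδ
    have ht : Tendsto (fun k => (1 - dil k) * (1 + 2 * (R + 1))) atTop (𝓝 0) := by
      simpa using (tendsto_dil.const_sub 1).mul_const (1 + 2 * (R + 1))
    filter_upwards [ht.eventually_lt_const hη] with k hk z
    have h1 := half_le_dil k
    have h2 := dil_lt_one k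
    rw [← dist_eq_norm]
    have hd : ∀ y ∈ Metric.ball (dil k • z) (bump k).rOut, ‖y - dil k • z‖ < 1 - dil k :=
        fun y hy => by
      rw [← bump_rOut]; exact mem_ball_iff_norm.1 hy
    have hn : ‖dil k • z‖ = dil k * ‖z‖ := by
      rw [norm_smul, Real.norm_of_nonneg (by linarith)]
    by_cases hz : z ∈ B
    · rw [Set.indicator_of_mem hz]
      refine dist_mollify_le _ hg hδ.le fun y hy => (hu ?_).le
      have hz' : ‖z‖ < 2 * (R + 1) := mem_ball_zero_iff.1 hz
      have h4 : ‖dil k • z - z‖ = (1 - dil k) * ‖z‖ := by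
        rw [← norm_neg, neg_sub, show z - dil k • z = (1 - dil k) • z by rw [sub_smul, one_smul],
          norm_smul, Real.norm_of_nonneg (by linarith)]
      calc dist y z ≤ ‖y - dil k • z‖ + ‖dil k • z - z‖ := by
            rw [dist_eq_norm]; exact norm_sub_le_norm_sub_add_norm_sub _ _ _
        _ ≤ (1 - dil k) + (1 - dil k) * (2 * (R + 1)) := by
            rw [h4]
            have := hd y hy
            gcongr
        _ < η := by linarith
    · rw [Set.indicator_of_notMem hz]
      have hz' : 2 * (R + 1) ≤ ‖z‖ := by simpa [hB] using hz
      rw [hR z (by linarith)]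
      refine dist_mollify_le _ hg le_rfl fun y hy => ?_
      have h5 := hd y hy
      have h6 : ‖dil k • z‖ - ‖y‖ ≤ ‖y - dil k • z‖ := by
        rw [← norm_neg (y - _), neg_sub]; exact norm_sub_norm_le _ _
      rw [hR y (by nlinarith), dist_self]
  rw [ENNReal.tendsto_nhds_zero]
  intro ε hε
  obtain ⟨δ, hδ0, hδ⟩ : ∃ δ : ℝ, 0 < δ ∧ ENNReal.ofReal δ * volume B ^ (1 / (2 : ℝ≥0∞).toReal)
      ≤ ε := by
    have hV : volume B ^ (1 / (2 : ℝ≥0∞).toReal) ≠ ⊤ :=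
        ENNReal.rpow_ne_top_of_nonneg (by positivity) hBv
    have : Tendsto (fun δ : ℝ => ENNReal.ofReal δ * volume B ^ (1 / (2 : ℝ≥0∞).toReal)) (𝓝[>] 0)
        (𝓝 0) := by
      have h0 : Tendsto (fun δ : ℝ => ENNReal.ofReal δ) (𝓝[>] 0) (𝓝 0) := by
        have := (ENNReal.continuous_ofReal.tendsto (0 : ℝ))
        rw [ENNReal.ofReal_zero] at this
        exact this.mono_left nhdsWithin_le_nhds
      simpa using ENNReal.Tendsto.mul_const h0 (Or.inr hV)
    obtain ⟨δ, h1, h2⟩ := ((ENNReal.tendsto_nhds_zero.1 this ε hε).and self_mem_nhdsWithin).exists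
    exact ⟨δ, h2, h1⟩
  filter_upwards [key δ hδ0] with k hk
  refine (eLpNorm_mono_real hk).trans (le_of_eq_of_le ?_ hδ)
  rw [eLpNorm_indicator_const Metric.isOpen_ball.measurableSet two_ne_zero (by norm_num),
    Real.enorm_of_nonneg hδ0.le]

/-- Mollified dilations converge to the identity on `L²`. -/
theorem tendsto_mollDil {h : ℂ → ℂ} (hh : Measurable h) (hL : MemLp h 2 volume) :
    Tendsto (fun k => eLpNorm (mollDil k h - h) 2 volume) atTop (𝓝 0) := by
  rw [ENNReal.tendsto_nhds_zero]
  intro ε hε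
  by_cases hεt : ε = ⊤
  · simp [hεt]
  have hε4 : ε / 4 ≠ 0 := by simpa using hε.ne'
  -- The error `h - g` is counted three times, twice through the operator bound `2` and once
  -- directly, and the continuous approximant contributes a fourth `ε / 4`.
  obtain ⟨g, hgc, hgε, hg, hgL⟩ := hL.exists_hasCompactSupport_eLpNorm_sub_le (by norm_num) hε4
  filter_upwards [ENNReal.tendsto_nhds_zero.1 (tendsto_mollDil_of_continuous hg hgc) (ε / 4)
    (pos_iff_ne_zero.2 hε4)] with k hk
  have hloc : LocallyIntegrable (h - g) := (hL.sub hgL).locallyIntegrable (by norm_num)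
  have hgl : LocallyIntegrable g := hg.locallyIntegrable
  have e : mollDil k h - h = (mollDil k (h - g) + (mollDil k g - g)) - (h - g) := by
    have : mollDil k h = mollDil k (h - g) + mollDil k g := by
      have := mollify_add (bump k) hloc hgl
      rw [sub_add_cancel] at this
      ext z; simp only [mollDil, this, Pi.add_apply]
    rw [this]; abel
  have hc {f : ℂ → ℂ} (hf : LocallyIntegrable f) : Continuous (mollDil k f) :=
    (contDiff_mollify (bump k) hf).continuous.comp (continuous_const_smul _)
  have h1 : eLpNorm (mollDil k (h - g)) 2 volume ≤ 2 * eLpNorm (h - g) 2 volume :=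
    eLpNorm_mollify_smul_le (bump k) (half_le_dil k) (hh.sub hg.measurable) hloc
  have m1 := (hc hloc).aestronglyMeasurable (μ := volume)
  have m2 : AEStronglyMeasurable (mollDil k g - g) volume := ((hc hgl).sub hg).aestronglyMeasurable
  rw [e]
  calc _ ≤ eLpNorm (mollDil k (h - g)) 2 volume + eLpNorm (mollDil k g - g) 2 volume
        + eLpNorm (h - g) 2 volume :=
        (eLpNorm_sub_le (m1.add m2) (hL.sub hgL).aestronglyMeasurable (by norm_num)).trans
          (by gcongr; exact eLpNorm_add_le m1 m2 (by norm_num))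
    _ ≤ 2 * (ε / 4) + ε / 4 + ε / 4 := by gcongr; exact h1.trans (by gcongr)
    _ = 4 * (ε / 4) := by ring
    _ = ε := ENNReal.mul_div_cancel (by norm_num) (by norm_num)

/-- Extension by zero of an element of `L²(Ω)`. -/
def extend (u : L2 disc) : ℂ → ℂ := disc.indicator u

lemma measurableSet_disc : MeasurableSet disc := Metric.isOpen_ball.measurableSet

lemma measurable_extend (u : L2 disc) : Measurable (extend u) :=
  (Lp.stronglyMeasurable u).measurable.indicator measurableSet_disc

lemma memLp_extend (u : L2 disc) : MemLp (extend u) 2 volume :=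
  (memLp_indicator_iff_restrict measurableSet_disc).2 (Lp.memLp u)

lemma locallyIntegrable_extend (u : L2 disc) : LocallyIntegrable (extend u) :=
  (memLp_extend u).locallyIntegrable (by norm_num)

lemma fderiv_mollify_apply (ρ : ContDiffBump (0 : ℂ)) {h : ℂ → ℂ} (hh : LocallyIntegrable h)
    (x e : ℂ) :
    fderiv ℝ (mollify ρ h) x e = ∫ w, h w * (fderiv ℝ (ρ.normed volume) (x - w) e : ℂ) := by
  have e1 : mollify ρ h = h ⋆[(ContinuousLinearMap.lsmul ℝ ℝ).flip, volume] ρ.normed volume :=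
    (convolution_flip _).symm
  have hρ : ContDiff ℝ 1 (ρ.normed volume) := ρ.contDiff_normed
  have h1 := ρ.hasCompactSupport_normed.hasFDerivAt_convolution_right
    (ContinuousLinearMap.lsmul ℝ ℝ : ℝ →L[ℝ] ℂ →L[ℝ] ℂ).flip (μ := volume) hh hρ x
  rw [e1, h1.fderiv, convolution_precompR_apply _ hh (ρ.hasCompactSupport_normed.fderiv ℝ)
    (hρ.continuous_fderiv one_ne_zero), convolution_def]
  refine integral_congr_ae (ae_of_all _ fun w => ?_)
  simp [mul_comm]

/-- Mollification commutes with weak derivatives away from the boundary. -/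
lemma fderiv_mollify_extend {u w : L2 disc} {e : ℂ} (huw : IsWeakDeriv disc e u w)
    (ρ : ContDiffBump (0 : ℂ)) {x : ℂ} (hx : ‖x‖ + ρ.rOut < 1) :
    fderiv ℝ (mollify ρ (extend u)) x e = mollify ρ (extend w) x := by
  -- The reflected kernel is an admissible test function exactly because its support, a ball about
  -- `x`, stays inside the disc.
  set ψ : ℂ → ℂ := fun y => (ρ.normed volume (x - y) : ℂ) with hψ
  have hρ : ContDiff ℝ ∞ (ρ.normed (volume : Measure ℂ)) := ρ.contDiff_normed
  have hψs : ContDiff ℝ ∞ ψ :=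
    Complex.ofRealCLM.contDiff.comp (hρ.comp (contDiff_const.sub contDiff_id))
  have hsub : tsupport ψ ⊆ Metric.closedBall x ρ.rOut := by
    refine closure_minimal (fun y hy => ?_) Metric.isClosed_closedBall
    have h1 : ρ.normed volume (x - y) ≠ 0 := by
      intro h0; exact hy (by simp [hψ, h0])
    have h2 : x - y ∈ Metric.ball (0 : ℂ) ρ.rOut := by
      rw [← ρ.support_normed_eq (μ := volume)]; exact h1
    rw [mem_ball_zero_iff] at h2
    rw [Metric.mem_closedBall, dist_comm, dist_eq_norm]
    exact h2.le
  have hdisc : Metric.closedBall x ρ.rOut ⊆ disc :=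
    Metric.closedBall_subset_ball' (by rw [dist_zero_right]; linarith)
  have hcs : HasCompactSupport ψ :=
    (isCompact_closedBall x ρ.rOut).of_isClosed_subset (isClosed_tsupport _) hsub
  have key := huw ψ hψs hcs (hsub.trans hdisc)
  have hd : ∀ y, fderiv ℝ ψ y e = -(fderiv ℝ (ρ.normed volume) (x - y) e : ℂ) := by
    intro y
    have h1 : HasFDerivAt (fun y : ℂ => x - y) (-ContinuousLinearMap.id ℝ ℂ) y :=
      (hasFDerivAt_id y).const_sub x
    have h2 := (Complex.ofRealCLM.hasFDerivAt (x := ρ.normed volume (x - y))).comp y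
      ((hρ.differentiable (by simp) (x - y)).hasFDerivAt.comp y h1)
    rw [show ψ = Complex.ofRealCLM ∘ (ρ.normed volume ∘ fun y => x - y) from rfl, h2.fderiv]
    simp
  have hext (f : L2 disc) (k : ℂ → ℂ) : ∫ y, extend f y * k y = ∫ y in disc, f y * k y := by
    rw [← integral_indicator measurableSet_disc]
    congr 1; ext y
    exact (Set.indicator_mul_left (s := disc) (f := f) (g := k) (i := y)).symm
  rw [fderiv_mollify_apply ρ (locallyIntegrable_extend u), hext]
  have hm : mollify ρ (extend w) x = ∫ y, extend w y * ψ y := by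
    rw [mollify, convolution_lsmul_swap]
    congr 1; ext y; simp [hψ, mul_comm]
  rw [hm, hext, ← neg_neg (∫ y in disc, w y * ψ y), ← key, ← integral_neg]
  congr 1; ext y; rw [hd]; ring

lemma contDiff_mollDil (k : ℕ) (u : L2 disc) : ContDiff ℝ ∞ (mollDil k (extend u)) :=
  (contDiff_mollify (bump k) (locallyIntegrable_extend u)).comp (contDiff_const_smul _)

/-- The bump radius is `1 - dil k`, so the averaging ball about `dil k • z` stays in the disc for
every `z` in it. The factor `dil k` comes from the chain rule and tends to `1`. -/
lemma fderiv_mollDil {u w : L2 disc} {e : ℂ} (huw : IsWeakDeriv disc e u w) (k : ℕ) {z : ℂ}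
    (hz : z ∈ disc) :
    fderiv ℝ (mollDil k (extend u)) z e = dil k * mollDil k (extend w) z := by
  have hd : 0 < dil k := by linarith [half_le_dil k]
  have hz' : ‖z‖ < 1 := mem_ball_zero_iff.1 hz
  have e1 : mollDil k (extend u) = fun z => mollify (bump k) (extend u) (dil k • z) := rfl
  rw [e1, fderiv_comp_smul, smul_apply, fderiv_mollify_extend huw, mollDil,
    Complex.real_smul]
  rw [norm_smul, Real.norm_of_nonneg hd.le, bump_rOut]
  nlinarith

lemma eLpNorm_restrict_mollDil_sub_le (k : ℕ) (u : L2 disc) :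
    eLpNorm (fun z => mollDil k (extend u) z - u z) 2 (volume.restrict disc) ≤
      eLpNorm (mollDil k (extend u) - extend u) 2 volume := by
  refine le_of_eq_of_le (eLpNorm_congr_ae ?_) (eLpNorm_mono_measure _ Measure.restrict_le_self)
  filter_upwards [ae_restrict_mem measurableSet_disc] with z hz
  simp [extend, hz]

lemma tendsto_mollDil_restrict (u : L2 disc) :
    Tendsto (fun k => eLpNorm (fun z => mollDil k (extend u) z - u z) 2 (volume.restrict disc))
      atTop (𝓝 0) :=
  tendsto_of_tendsto_of_tendsto_of_le_of_le tendsto_const_nhds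
    (tendsto_mollDil (measurable_extend u) (memLp_extend u)) (fun _ => zero_le)
    (fun k => eLpNorm_restrict_mollDil_sub_le k u)

lemma tendsto_fderiv_mollDil {u w : L2 disc} {e : ℂ} (huw : IsWeakDeriv disc e u w) :
    Tendsto (fun k => eLpNorm (fun z => fderiv ℝ (mollDil k (extend u)) z e - w z) 2
      (volume.restrict disc)) atTop (𝓝 0) := by
  have hb : ∀ k, eLpNorm (fun z => fderiv ℝ (mollDil k (extend u)) z e - w z)
      2 (volume.restrict disc) ≤
      eLpNorm (fun z => mollDil k (extend w) z - w z) 2 (volume.restrict disc)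
        + ‖((dil k - 1 : ℝ) : ℂ)‖ₑ * eLpNorm w 2 (volume.restrict disc) := by
    intro k
    have e1 : (fun z => fderiv ℝ (mollDil k (extend u)) z e - w z) =ᵐ[volume.restrict disc]
        (dil k : ℂ) • (fun z => mollDil k (extend w) z - w z) + ((dil k - 1 : ℝ) : ℂ) • ⇑w := by
      filter_upwards [ae_restrict_mem measurableSet_disc] with z hz
      rw [fderiv_mollDil huw k hz]
      simp; ring
    have m1 : AEStronglyMeasurable (fun z => mollDil k (extend w) z - w z) (volume.restrict disc) :=
      (contDiff_mollDil k w).continuous.aestronglyMeasurable.sub (Lp.aestronglyMeasurable w)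
    rw [eLpNorm_congr_ae e1]
    refine (eLpNorm_add_le (m1.const_smul _) ((Lp.aestronglyMeasurable w).const_smul _)
      (by norm_num)).trans ?_
    rw [eLpNorm_const_smul, eLpNorm_const_smul]
    gcongr
    refine mul_le_of_le_one_left' ?_
    rw [← ofReal_norm, Complex.norm_real, Real.norm_of_nonneg (by linarith [half_le_dil k])]
    exact ENNReal.ofReal_le_one.2 (dil_lt_one k).le
  refine tendsto_of_tendsto_of_tendsto_of_le_of_le tendsto_const_nhds ?_ (fun _ => zero_le) hb
  have h0 : Tendsto (fun k => ‖((dil k - 1 : ℝ) : ℂ)‖ₑ) atTop (𝓝 0) := by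
    have h1 : Tendsto (fun k => ((dil k - 1 : ℝ) : ℂ)) atTop (𝓝 0) := by
      have := (Complex.continuous_ofReal.tendsto _).comp (tendsto_dil.sub_const 1)
      rwa [sub_self, Complex.ofReal_zero] at this
    simpa using h1.enorm
  have h2 := ENNReal.Tendsto.mul_const (b := eLpNorm w 2 (volume.restrict disc)) h0
    (Or.inr (Lp.eLpNorm_ne_top w))
  simpa using (tendsto_mollDil_restrict w).add h2

/-- Functions smooth up to the boundary are dense in `H¹(Ω)`. -/
theorem exists_smooth_approx (u : H1 disc) : ∃ φ : ℕ → ℂ → ℂ, (∀ n, ContDiff ℝ ∞ (φ n)) ∧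
    Tendsto (fun n => eLpNorm (fun z => φ n z - u.val z) 2 (volume.restrict disc)) atTop (𝓝 0) ∧
    Tendsto (fun n => eLpNorm (fun z => fderiv ℝ (φ n) z 1 - u.dx z) 2 (volume.restrict disc))
      atTop (𝓝 0) ∧
    Tendsto (fun n => eLpNorm (fun z => fderiv ℝ (φ n) z Complex.I - u.dy z) 2
      (volume.restrict disc)) atTop (𝓝 0) :=
  ⟨fun k => mollDil k (extend u.val), fun k => contDiff_mollDil k u.val,
    tendsto_mollDil_restrict u.val, tendsto_fderiv_mollDil u.isWeakDeriv_dx,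
    tendsto_fderiv_mollDil u.isWeakDeriv_dy⟩

/-! ### Traces of `H¹` functions -/

lemma discLp_congr {F G : ℂ → ℂ} (h : F = G) (hF : Continuous F) (hG : Continuous G) :
    discLp F hF = discLp G hG := by
  subst h; rfl

/-- The squared distance of `F` and its gradient to a triple of elements of `L²(Ω)`. -/
def gradDistSq {F : ℂ → ℂ} (hF : ContDiff ℝ 1 F) (x y z : L2 disc) : ℝ≥0∞ :=
  ‖discLp F hF.continuous - x‖ₑ ^ 2
    + ‖discLp (fun z => fderiv ℝ F z 1) (continuous_fderiv_apply hF 1) - y‖ₑ ^ 2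
    + ‖discLp (fun z => fderiv ℝ F z Complex.I) (continuous_fderiv_apply hF Complex.I) - z‖ₑ ^ 2

/-- The trace inequality for `F - G`, with the data of `G` entering only as elements of `L²(Ω)`. In
this form `G` can be replaced by the limit of a smooth sequence. -/
lemma exists_halfNormSq_sub_le : ∃ C : ℝ≥0∞, C ≠ ⊤ ∧
    (∀ (F : ℂ → ℂ) (hF : ContDiff ℝ 1 F), halfNormSq (circLp F hF.continuous)
      ≤ C * gradDistSq hF 0 0 0) ∧
    ∀ (F G : ℂ → ℂ) (hF : ContDiff ℝ 1 F) (hG : ContDiff ℝ 1 G),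
      halfNormSq (circLp F hF.continuous - circLp G hG.continuous) ≤
        C * gradDistSq hF (discLp G hG.continuous)
          (discLp (fun z => fderiv ℝ G z 1) (continuous_fderiv_apply hG 1))
          (discLp (fun z => fderiv ℝ G z Complex.I) (continuous_fderiv_apply hG Complex.I)) := by
  obtain ⟨C, hC, h⟩ := exists_halfNormSq_circLp_le
  refine ⟨C, hC, fun F hF => ?_, fun F G hF hG => ?_⟩
  · simpa [gradDistSq, smoothNormSq] using h F hF
  · have h1 := h _ (hF.sub hG)
    have e (e : ℂ) : discLp (fun z => fderiv ℝ (fun w => F w - G w) z e)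
        (continuous_fderiv_apply (hF.sub hG) e) =
        discLp (fun z => fderiv ℝ F z e) (continuous_fderiv_apply hF e) -
          discLp (fun z => fderiv ℝ G z e) (continuous_fderiv_apply hG e) := by
      rw [← discLp_sub]
      exact discLp_congr (funext fun z => fderiv_sub_apply hF hG z e) _ _
    rw [smoothNormSq, e, e, discLp_sub, circLp_sub] at h1
    exact h1

/-- A family of smooth functions converges in `H¹(Ω)`. -/
structure SmoothApprox {ι : Type*} (l : Filter ι) (u : H1 disc) (φ : ι → ℂ → ℂ)
    (hφ : ∀ n, ContDiff ℝ 1 (φ n)) : Prop where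
  val : Tendsto (fun n => discLp (φ n) (hφ n).continuous) l (𝓝 u.val)
  dx : Tendsto (fun n => discLp (fun z => fderiv ℝ (φ n) z 1) (continuous_fderiv_apply (hφ n) 1))
    l (𝓝 u.dx)
  dy : Tendsto (fun n => discLp (fun z => fderiv ℝ (φ n) z Complex.I)
    (continuous_fderiv_apply (hφ n) Complex.I)) l (𝓝 u.dy)

lemma tendsto_discLp_iff {ι : Type*} {l : Filter ι} {φ : ι → ℂ → ℂ} (hφ : ∀ n, Continuous (φ n))
    (x : L2 disc) : Tendsto (fun n => discLp (φ n) (hφ n)) l (𝓝 x) ↔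
      Tendsto (fun n => eLpNorm (fun z => φ n z - x z) 2 (volume.restrict disc)) l (𝓝 0) := by
  rw [tendsto_iff_edist_tendsto_0]
  refine tendsto_congr fun n => ?_
  rw [edist_eq_enorm_sub, Lp.enorm_def]
  refine eLpNorm_congr_ae ?_
  filter_upwards [Lp.coeFn_sub (discLp (φ n) (hφ n)) x, coeFn_discLp (hφ n)] with z h1 h2
  rw [h1, Pi.sub_apply, h2]

lemma tendsto_circLp_iff {ι : Type*} {l : Filter ι} {φ : ι → ℂ → ℂ} (hφ : ∀ n, Continuous (φ n))
    (g : L2Circle) : Tendsto (fun n => circLp (φ n) (hφ n)) l (𝓝 g) ↔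
      Tendsto (fun n => eLpNorm (fun β : AddCircle (2 * Real.pi) =>
        φ n (AddCircle.toCircle β : ℂ) - g β) 2 AddCircle.haarAddCircle) l (𝓝 0) := by
  rw [tendsto_iff_edist_tendsto_0]
  refine tendsto_congr fun n => ?_
  rw [edist_eq_enorm_sub, Lp.enorm_def]
  refine eLpNorm_congr_ae ?_
  filter_upwards [Lp.coeFn_sub (circLp (φ n) (hφ n)) g, coeFn_circLp (hφ n)] with z h1 h2
  rw [h1, Pi.sub_apply, h2]

lemma SmoothApprox.comp {ι κ : Type*} {l : Filter ι} {m : Filter κ} {u : H1 disc} {φ : ι → ℂ → ℂ}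
    {hφ : ∀ n, ContDiff ℝ 1 (φ n)} (h : SmoothApprox l u φ hφ) {f : κ → ι} (hf : Tendsto f m l) :
    SmoothApprox m u (fun n => φ (f n)) (fun n => hφ (f n)) :=
  ⟨h.val.comp hf, h.dx.comp hf, h.dy.comp hf⟩

lemma isTrace_iff (u : H1 disc) (g : L2Circle) : IsTrace u g ↔
    ∃ (φ : ℕ → ℂ → ℂ) (hφ : ∀ n, ContDiff ℝ ∞ (φ n)),
      SmoothApprox atTop u φ (fun n => (hφ n).of_le (by simp)) ∧
      Tendsto (fun n => circLp (φ n) (hφ n).continuous) atTop (𝓝 g) := by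
  constructor
  · rintro ⟨φ, hφ, h1, h2, h3, h4⟩
    exact ⟨φ, hφ, ⟨(tendsto_discLp_iff _ _).2 h1, (tendsto_discLp_iff _ _).2 h2,
      (tendsto_discLp_iff _ _).2 h3⟩, (tendsto_circLp_iff _ _).2 h4⟩
  · rintro ⟨φ, hφ, ⟨h1, h2, h3⟩, h4⟩
    exact ⟨φ, hφ, (tendsto_discLp_iff _ _).1 h1, (tendsto_discLp_iff _ _).1 h2,
      (tendsto_discLp_iff _ _).1 h3, (tendsto_circLp_iff _ _).1 h4⟩

lemma tendsto_enorm_sub_sq {ι : Type*} {l : Filter ι} {E : Type*} [NormedAddCommGroup E]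
    {x y : ι → E} {a b : E} (hx : Tendsto x l (𝓝 a)) (hy : Tendsto y l (𝓝 b)) :
    Tendsto (fun n => ‖x n - y n‖ₑ ^ 2) l (𝓝 (‖a - b‖ₑ ^ 2)) :=
  ((ENNReal.continuous_pow 2).tendsto _).comp (hx.sub hy).enorm

lemma SmoothApprox.tendsto_gradDistSq {ι : Type*} {l : Filter ι} {u : H1 disc} {φ : ι → ℂ → ℂ}
    {hφ : ∀ n, ContDiff ℝ 1 (φ n)} (h : SmoothApprox l u φ hφ) {x y z : ι → L2 disc}
      {a b c : L2 disc}
    (hx : Tendsto x l (𝓝 a)) (hy : Tendsto y l (𝓝 b)) (hz : Tendsto z l (𝓝 c)) :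
    Tendsto (fun n => gradDistSq (hφ n) (x n) (y n) (z n)) l
      (𝓝 (‖u.val - a‖ₑ ^ 2 + ‖u.dx - b‖ₑ ^ 2 + ‖u.dy - c‖ₑ ^ 2)) :=
  ((tendsto_enorm_sub_sq h.val hx).add (tendsto_enorm_sub_sq h.dx hy)).add
    (tendsto_enorm_sub_sq h.dy hz)

lemma SmoothApprox.tendsto_gradDistSq_self {ι : Type*} {l : Filter ι} {u : H1 disc} {φ : ι → ℂ → ℂ}
    {hφ : ∀ n, ContDiff ℝ 1 (φ n)} (h : SmoothApprox l u φ hφ) {x y z : ι → L2 disc}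
    (hx : Tendsto x l (𝓝 u.val)) (hy : Tendsto y l (𝓝 u.dx)) (hz : Tendsto z l (𝓝 u.dy)) {C : ℝ≥0∞}
    (hC : C ≠ ⊤) : Tendsto (fun n => C * gradDistSq (hφ n) (x n) (y n) (z n)) l (𝓝 0) := by
  have := ENNReal.Tendsto.const_mul (h.tendsto_gradDistSq hx hy hz) (Or.inr hC)
  simpa using this

/-- The trace inequality forces two approximations of the same `u` to have the same boundary
behaviour. For two sequences this gives uniqueness of the trace; along a product filter it gives the
Cauchy property, hence existence. -/
lemma SmoothApprox.tendsto_norm_circLp_sub {ι : Type*} {l : Filter ι} {u : H1 disc} {φ ψ : ι → ℂ →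
    ℂ}
    {hφ : ∀ n, ContDiff ℝ 1 (φ n)} {hψ : ∀ n, ContDiff ℝ 1 (ψ n)} (h : SmoothApprox l u φ hφ)
    (h' : SmoothApprox l u ψ hψ) :
    Tendsto (fun n => circLp (φ n) (hφ n).continuous - circLp (ψ n) (hψ n).continuous) l (𝓝 0) := by
  obtain ⟨C, hC, -, hb⟩ := exists_halfNormSq_sub_le
  have h0 := h.tendsto_gradDistSq_self h'.val h'.dx h'.dy hC
  have h1 : Tendsto (fun n => ‖circLp (φ n) (hφ n).continuous - circLp (ψ n)
      (hψ n).continuous‖ₑ ^ 2)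
      l (𝓝 0) :=
    tendsto_of_tendsto_of_tendsto_of_le_of_le tendsto_const_nhds h0 (fun _ => zero_le)
      (fun n => (enorm_sq_le_halfNormSq _).trans (hb _ _ (hφ n) (hψ n)))
  have h2 := ((ENNReal.continuous_rpow_const (y := 1 / 2)).tendsto 0).comp h1
  rw [tendsto_iff_edist_tendsto_0]
  rw [ENNReal.zero_rpow_of_pos (by norm_num)] at h2
  refine h2.congr fun n => ?_
  rw [Function.comp_apply, edist_zero_right, ← ENNReal.rpow_natCast, ← ENNReal.rpow_mul]
  norm_num

/-- The trace is unique. -/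
lemma IsTrace.unique {u : H1 disc} {g h : L2Circle} (hg : IsTrace u g) (hh : IsTrace u h) : g =
    h := by
  rw [isTrace_iff] at hg hh
  obtain ⟨φ, hφ, h1, h2⟩ := hg
  obtain ⟨ψ, hψ, h3, h4⟩ := hh
  exact sub_eq_zero.1 (tendsto_nhds_unique (h2.sub h4) (h1.tendsto_norm_circLp_sub h3))

/-- The trace exists. -/
lemma exists_isTrace (u : H1 disc) : ∃ g, IsTrace u g := by
  obtain ⟨φ, hφ, h1, h2, h3⟩ := exists_smooth_approx u
  have hφ1 : ∀ n, ContDiff ℝ 1 (φ n) := fun n => (hφ n).of_le (by simp)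
  have ha : SmoothApprox atTop u φ hφ1 := ⟨(tendsto_discLp_iff _ _).2 h1,
    (tendsto_discLp_iff _ _).2 h2, (tendsto_discLp_iff _ _).2 h3⟩
  have hc : CauchySeq fun n => circLp (φ n) (hφ n).continuous := by
    rw [cauchySeq_iff_tendsto, tendsto_uniformity_iff_dist_tendsto_zero, ← prod_atTop_atTop_eq]
    -- The two coordinates of the index pair are treated as two approximations of `u` along `atTop
    -- ×ˢ atTop`.
    have := ((ha.comp tendsto_fst).tendsto_norm_circLp_sub (ha.comp tendsto_snd) :
      Tendsto _ (atTop ×ˢ atTop) _).norm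
    rw [norm_zero] at this
    exact this.congr fun p => (dist_eq_norm _ _).symm
  obtain ⟨g, hg⟩ := cauchySeq_tendsto_of_complete hc
  exact ⟨g, (isTrace_iff u g).2 ⟨φ, hφ, ha, hg⟩⟩

lemma continuous_fourierCoeff (k : ℤ) : Continuous fun g : L2Circle => fourierCoeff g k := by
  have e : (fun g : L2Circle => fourierCoeff g k) =
      fun g => inner ℂ (fourierBasis (T := 2 * Real.pi) k) g := by
    ext g; rw [← fourierBasis_repr, HilbertBasis.repr_apply_apply]
  rw [e]
  exact continuous_const.inner continuous_id

/-- The `H^{1/2}(Γ)` norm is lower semicontinuous on `L²(Γ)`. -/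
lemma halfNormSq_le_of_tendsto {ι : Type*} {l : Filter ι} [NeBot l] {g : ι → L2Circle}
    {h : L2Circle}
    {a : ι → ℝ≥0∞} {b : ℝ≥0∞} (hg : Tendsto g l (𝓝 h)) (ha : Tendsto a l (𝓝 b))
    (hle : ∀ n, halfNormSq (g n) ≤ a n) : halfNormSq h ≤ b := by
  -- Each finite partial sum is continuous on `L²(Γ)`, and the norm is their supremum.
  rw [halfNormSq, ENNReal.tsum_eq_iSup_sum]
  refine iSup_le fun s => ?_
  have h1 : Tendsto (fun n => ∑ k ∈ s, ENNReal.ofReal ((1 + (k : ℝ) ^ 2) ^ (1 / 2 : ℝ)) *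
      ‖fourierCoeff (g n) k‖ₑ ^ 2) l (𝓝 (∑ k ∈ s, ENNReal.ofReal ((1 + (k : ℝ) ^ 2) ^ (1 / 2 : ℝ)) *
      ‖fourierCoeff h k‖ₑ ^ 2)) := by
    refine tendsto_finsetSum _ fun k _ =>
      ENNReal.Tendsto.const_mul ?_ (Or.inr ENNReal.ofReal_ne_top)
    exact ((ENNReal.continuous_pow 2).tendsto _).comp
      (((continuous_fourierCoeff k).tendsto h).comp hg).enorm
  exact le_of_tendsto_of_tendsto' h1 ha fun n => (ENNReal.sum_le_tsum s).trans (hle n)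

/-- The trace is bounded from `H¹(Ω)` to `H^{1/2}(Γ)`. -/
theorem exists_halfNormSq_trace_le : ∃ C : ℝ≥0∞, C ≠ ⊤ ∧ ∀ (u : H1 disc) (g : L2Circle),
    IsTrace u g → halfNormSq g ≤ C * u.normSq := by
  obtain ⟨C, hC, hb, -⟩ := exists_halfNormSq_sub_le
  refine ⟨C, hC, fun u g hg => ?_⟩
  obtain ⟨φ, hφ, h1, h2⟩ := (isTrace_iff u g).1 hg
  have h3 := ENNReal.Tendsto.const_mul (h1.tendsto_gradDistSq (tendsto_const_nhds (x := 0))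
    (tendsto_const_nhds (x := 0)) (tendsto_const_nhds (x := 0))) (Or.inr hC)
  refine halfNormSq_le_of_tendsto h2 (h3.trans_eq ?_) fun n => hb _ _
  simp [H1.normSq]

/-- The energy inequality: `∂` is controlled by `∂̄` and the boundary values. -/
theorem enorm_del_sq_le {u : H1 disc} {g : L2Circle} (hg : IsTrace u g) :
    ‖u.del‖ₑ ^ 2 ≤ ‖u.delbar‖ₑ ^ 2 + ENNReal.ofReal Real.pi * halfNormSq g := by
  obtain ⟨C, hC, -, hb⟩ := exists_halfNormSq_sub_le
  obtain ⟨φ, hφ, h1, h2⟩ := (isTrace_iff u g).1 hg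
  have hφ1 : ∀ n, ContDiff ℝ 1 (φ n) := fun n => (hφ n).of_le (by simp)
  have hφ2 : ∀ n, ContDiff ℝ 2 (φ n) := fun n => by exact_mod_cast contDiff_infty.1 (hφ n) 2
  set b : ℕ → ℝ≥0∞ := fun n => (C * gradDistSq (hφ1 n) u.val u.dx u.dy) ^ (1 / 2 : ℝ) with hbdef
  have hsq (x : ℝ≥0∞) : (x ^ (1 / 2 : ℝ)) ^ 2 = x := by
    rw [← ENNReal.rpow_natCast, ← ENNReal.rpow_mul]; norm_num
  have hb0 : Tendsto b atTop (𝓝 0) := by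
    have := ((ENNReal.continuous_rpow_const (y := 1 / 2)).tendsto 0).comp
      (h1.tendsto_gradDistSq_self tendsto_const_nhds tendsto_const_nhds tendsto_const_nhds hC)
    rwa [ENNReal.zero_rpow_of_pos (by norm_num)] at this
  -- Fix `n` and let the second index tend to infinity in the trace inequality for `φ n - φ m`:
  -- lower semicontinuity turns it into convergence of the boundary values in `H^{1/2}`.
  have hdist : ∀ n, halfNormSq (circLp (φ n) (hφ1 n).continuous - g) ≤ b n ^ 2 := by
    intro n
    rw [hbdef, hsq]
    have ht : Tendsto (fun m => C * gradDistSq (hφ1 n) (discLp (φ m) (hφ1 m).continuous)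
        (discLp (fun z => fderiv ℝ (φ m) z 1) (continuous_fderiv_apply (hφ1 m) 1))
        (discLp (fun z => fderiv ℝ (φ m) z Complex.I) (continuous_fderiv_apply (hφ1 m) Complex.I)))
        atTop (𝓝 (C * gradDistSq (hφ1 n) u.val u.dx u.dy)) :=
      ENNReal.Tendsto.const_mul (((tendsto_enorm_sub_sq tendsto_const_nhds h1.val).add
        (tendsto_enorm_sub_sq tendsto_const_nhds h1.dx)).add
        (tendsto_enorm_sub_sq tendsto_const_nhds h1.dy)) (Or.inr hC)
    exact halfNormSq_le_of_tendsto (h2.const_sub _) ht fun m => hb _ _ (hφ1 n) (hφ1 m)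
  have hle : ∀ n, ‖discLp (dz (φ n)) (continuous_dz (hφ1 n))‖ₑ ^ 2 ≤
      ‖discLp (dzbar (φ n)) (continuous_dzbar (hφ1 n))‖ₑ ^ 2 +
        ENNReal.ofReal Real.pi * (halfNormSq g ^ (1 / 2 : ℝ) + b n) ^ 2 := by
    intro n
    refine (enorm_dz_sq_le_dzbar (hφ2 n) (hφ1 n)).trans ?_
    gcongr
    have := halfNormSq_add_le g (circLp (φ n) (hφ1 n).continuous - g)
      (a := halfNormSq g ^ (1 / 2 : ℝ)) (hsq _).ge (hdist n)
    rwa [add_sub_cancel] at this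
  have l1 : Tendsto (fun n => ‖discLp (dz (φ n)) (continuous_dz (hφ1 n))‖ₑ ^ 2) atTop
      (𝓝 (‖u.del‖ₑ ^ 2)) :=
    ((ENNReal.continuous_pow 2).tendsto _).comp
      ((h1.dx.sub (h1.dy.const_smul Complex.I)).const_smul (1 / 2 : ℂ)).enorm
  have l2 : Tendsto (fun n => ‖discLp (dzbar (φ n)) (continuous_dzbar (hφ1 n))‖ₑ ^ 2) atTop
      (𝓝 (‖u.delbar‖ₑ ^ 2)) :=
    ((ENNReal.continuous_pow 2).tendsto _).comp
      ((h1.dx.add (h1.dy.const_smul Complex.I)).const_smul (1 / 2 : ℂ)).enorm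
  have l3 : Tendsto (fun n => ENNReal.ofReal Real.pi * (halfNormSq g ^ (1 / 2 : ℝ) + b n) ^ 2) atTop
      (𝓝 (ENNReal.ofReal Real.pi * halfNormSq g)) := by
    have := ENNReal.Tendsto.const_mul (((ENNReal.continuous_pow 2).tendsto _).comp
      (hb0.const_add (halfNormSq g ^ (1 / 2 : ℝ)))) (Or.inr (ENNReal.ofReal_ne_top (r := Real.pi)))
    rw [add_zero, hsq] at this
    exact this
  exact le_of_tendsto_of_tendsto' l1 (l2.add l3) hle

/-! ### The weighted recursion -/

lemma ennreal_two_mul_le (a b : ℝ≥0∞) : 2 * a * b ≤ a ^ 2 + b ^ 2 := by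
  wlog h : a ≤ b generalizing a b
  · rw [mul_right_comm, add_comm]; exact this b a (le_of_not_ge h)
  obtain ⟨c, rfl⟩ := exists_add_of_le h
  calc 2 * a * (a + c) ≤ 2 * a * (a + c) + c ^ 2 := le_self_add
    _ = _ := by ring

/-- The weighted summation of a two-step recursive energy inequality. -/
theorem tsum_sq_le_of_recursion {A F B : ℕ → ℝ≥0∞}
    (hrec : ∀ j, A j ^ 2 ≤ (F j + A (j + 2)) ^ 2 + B j) {w : ℕ → ℝ≥0∞} (hw0 : w 0 = 1) (hw1 : w 1 =
      1)
    (hw : ∀ j, w (j + 2) = w j + 1) (hw' : ∀ j, 1 ≤ w j) (hfin : ∑' j, w j * A j ^ 2 ≠ ⊤) :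
    ∑' j, A j ^ 2 ≤ 6 * ∑' j, w j ^ 2 * F j ^ 2 + 2 * ∑' j, w j * B j := by
  have split (f : ℕ → ℝ≥0∞) : ∑' j, f j = f 0 + (f 1 + ∑' j, f (j + 2)) := by
    rw [tsum_eq_zero_add' ENNReal.summable, tsum_eq_zero_add' ENNReal.summable]
  set S := ∑' j, A j ^ 2 with hS
  set T := ∑' j, w j * A (j + 2) ^ 2 with hT
  -- Shifting the index by two and using `w (j + 2) = w j + 1` isolates the unweighted sum `S`.
  have e1 : ∑' j, w j * A j ^ 2 = S + T := by
    rw [split, hS, split fun j => A j ^ 2, hw0, hw1, one_mul, one_mul]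
    simp_rw [hw, add_mul, one_mul]
    rw [ENNReal.tsum_add]; ring
  have hST : S + T ≠ ⊤ := e1 ▸ hfin
  have hSf : S ≠ ⊤ := fun h => hST (by simp [h])
  have hTf : T ≠ ⊤ := fun h => hST (by simp [h])
  -- The recursion is doubled so that Young's inequality for the cross term `2 (2 w F) A` costs one
  -- copy of `A (j + 2) ^ 2`, that is, only half of the `2 S` on the left. The constant `6` is `2`
  -- from `F²`, using `w ≤ w²`, plus `4` from `(2 w F)²`.
  have hstep : ∀ j, 2 * (w j * A j ^ 2) ≤ 6 * (w j ^ 2 * F j ^ 2) + A (j + 2) ^ 2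
      + 2 * (w j * A (j + 2) ^ 2) + 2 * (w j * B j) := by
    intro j
    have hsq : w j ≤ w j ^ 2 := le_self_pow₀ (hw' j) two_ne_zero
    calc 2 * (w j * A j ^ 2) ≤ 2 * (w j * ((F j + A (j + 2)) ^ 2 + B j)) := by gcongr; exact hrec j
      _ = 2 * (w j * F j ^ 2) + 2 * (2 * w j * F j) * A (j + 2) + 2 * (w j * A (j + 2) ^ 2)
          + 2 * (w j * B j) := by ring
      _ ≤ 2 * (w j ^ 2 * F j ^ 2) + ((2 * w j * F j) ^ 2 + A (j + 2) ^ 2) + 2 * (w j * A (j + 2)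
          ^ 2)
          + 2 * (w j * B j) := by gcongr; exact ennreal_two_mul_le _ _
      _ = _ := by ring
  have hsum := ENNReal.tsum_le_tsum hstep
  rw [ENNReal.tsum_add, ENNReal.tsum_add, ENNReal.tsum_add, ENNReal.tsum_mul_left,
    ENNReal.tsum_mul_left,
    ENNReal.tsum_mul_left, ENNReal.tsum_mul_left, e1] at hsum
  have hA : ∑' j, A (j + 2) ^ 2 ≤ S := by
    rw [hS, split fun j => A j ^ 2]; exact le_add_self.trans le_add_self
  set X := ∑' j, w j ^ 2 * F j ^ 2
  set Y := ∑' j, w j * B j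
  have h2 : S + (S + 2 * T) ≤ 6 * X + 2 * Y + (S + 2 * T) :=
    calc S + (S + 2 * T) = 2 * (S + T) := by ring
      _ ≤ 6 * X + S + 2 * T + 2 * Y := hsum.trans (by gcongr)
      _ = _ := by ring
  -- Cancelling `S + 2 * T` requires it to be finite, which is the role of `hfin`.
  exact (ENNReal.add_le_add_iff_right (by finiteness)).1 h2

/-- Places the integer weight of the recursion below the weight of `l^{2,1/2}`; its square is then
below that of `l^{2,1}`. -/
lemma half_add_one_le (j : ℕ) : ((j / 2 + 1 : ℕ) : ℝ) ≤ (1 + (j : ℝ) ^ 2) ^ (1 / 2 : ℝ) := by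
  rw [← Real.sqrt_eq_rpow]
  refine Real.le_sqrt_of_sq_le ?_
  have h : (j / 2 + 1) ^ 2 ≤ 1 + j ^ 2 := by
    obtain hj | hj := Nat.lt_or_ge j 2
    · interval_cases j <;> simp
    · have h1 : j / 2 + 1 ≤ j := by omega
      have := Nat.pow_le_pow_left h1 2
      omega
  exact_mod_cast h

lemma one_add_sq_rpow_half_sq (j : ℝ) : ((1 + j ^ 2) ^ (1 / 2 : ℝ)) ^ 2 = (1 + j ^ 2) ^ (1 : ℝ) :=
    by
  rw [← Real.rpow_mul_natCast (by positivity)]; norm_num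

end BukhgeimBeltrami

end

/-! ### The estimate for the Beltrami system -/

open BukhgeimBeltrami in
/-- Sequences `⟨u₀, u₋₁, u₋₂, …⟩` are indexed by `j ∈ ℕ`, the term `u j` being `u₋ⱼ`. The sequence
`g` is the trace of `v` on the unit circle. -/
theorem corollary4p4 (f : ℕ → L2 disc) (hf : normSqL2 1 f < ⊤)
    (v : ℕ → H1 disc) (hv : normSqH1 (1 / 2) v < ⊤)
    (heq : (fun j => (v j).delbar) + leftShift^[2] (fun j => (v j).del) = f) :
    ∃ g : ℕ → L2Circle, (∀ j h, IsTrace (v j) h ↔ h = g j) ∧ normSqHalf (1 / 2) g < ⊤ ∧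
      normSqL2 0 (fun j => (v j).del) ≤
        12 * normSqL2 1 f + ENNReal.ofReal (2 * Real.pi) * normSqHalf (1 / 2) g := by
  choose g hg using fun j => exists_isTrace (v j)
  refine ⟨g, fun j h => ⟨fun hh => hh.unique (hg j), fun hh => hh ▸ hg j⟩, ?_, ?_⟩
  · obtain ⟨C, hC, hb⟩ := exists_halfNormSq_trace_le
    have : normSqHalf (1 / 2) g ≤ C * normSqH1 (1 / 2) v := by
      rw [normSqHalf, normSqH1, weightedSum, weightedSum, ← ENNReal.tsum_mul_left]
      refine ENNReal.tsum_le_tsum fun j => ?_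
      rw [mul_left_comm]
      gcongr
      exact hb _ _ (hg j)
    exact this.trans_lt (ENNReal.mul_lt_top hC.lt_top hv)
  -- This weight starts at `1` for both parities and grows by exactly `1` under the double shift.
  set w : ℕ → ℝ≥0∞ := fun j => ((j / 2 + 1 : ℕ) : ℝ≥0∞) with hwdef
  have hwle : ∀ j, w j ≤ ENNReal.ofReal ((1 + (j : ℝ) ^ 2) ^ (1 / 2 : ℝ)) := fun j => by
    simp only [hwdef]
    rw [← ENNReal.ofReal_natCast]
    exact ENNReal.ofReal_le_ofReal (half_add_one_le j)
  have hw2 : ∀ j, w j ^ 2 ≤ ENNReal.ofReal ((1 + (j : ℝ) ^ 2) ^ (1 : ℝ)) := fun j => by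
    refine (pow_le_pow_left' (hwle j) 2).trans_eq ?_
    rw [← ENNReal.ofReal_pow (by positivity), one_add_sq_rpow_half_sq]
  have hrec : ∀ j, ‖(v j).del‖ₑ ^ 2 ≤ (‖f j‖ₑ + ‖(v (j + 2)).del‖ₑ) ^ 2
      + ENNReal.ofReal Real.pi * halfNormSq (g j) := fun j => by
    have h1 : (v j).delbar + (v (j + 2)).del = f j := congrFun heq j
    have h2 : (v j).delbar = f j - (v (j + 2)).del := eq_sub_of_add_eq h1
    refine (enorm_del_sq_le (hg j)).trans ?_
    rw [h2]
    gcongr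
    exact enorm_sub_le
  have hdel : ∀ j, ‖(v j).del‖ₑ ^ 2 ≤ (v j).normSq := fun j => by
    rw [H1.normSq, add_assoc]
    exact (enorm_half_sub_sq_le _ _).trans le_add_self
  -- The `l^{2,1/2}` decay of `v` is what makes the cancellation in the recursion legitimate.
  have hfin : ∑' j, w j * ‖(v j).del‖ₑ ^ 2 ≠ ⊤ := by
    refine (lt_of_le_of_lt (ENNReal.tsum_le_tsum fun j => ?_) hv).ne
    exact mul_le_mul' (hwle j) (hdel j)
  have hmain := tsum_sq_le_of_recursion hrec (w := w) (by simp [hwdef]) (by simp [hwdef])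
    (fun j => by
      have : (j + 2) / 2 + 1 = (j / 2 + 1) + 1 := by omega
      simp only [hwdef, this]; push_cast; ring)
    (fun j => by simp [hwdef]) hfin
  calc normSqL2 0 (fun j => (v j).del) = ∑' j, ‖(v j).del‖ₑ ^ 2 := by
        simp [normSqL2, weightedSum]
    _ ≤ 6 * ∑' j, w j ^ 2 * ‖f j‖ₑ ^ 2
        + 2 * ∑' j, w j * (ENNReal.ofReal Real.pi * halfNormSq (g j)) := hmain
    _ ≤ 12 * normSqL2 1 f + 2 * (ENNReal.ofReal Real.pi * normSqHalf (1 / 2) g) := by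
        rw [normSqL2, normSqHalf, weightedSum, weightedSum, ← ENNReal.tsum_mul_left (a := ENNReal.ofReal Real.pi)]
        -- The recursion gives the constant `6` in front of `f`, which is relaxed to `12`; the
        -- boundary constant `2π` is the `2` of the recursion times the `π` of the energy
        -- inequality.
        gcongr ?_ * ?_ + 2 * ?_
        · norm_num
        · exact ENNReal.tsum_le_tsum fun j => mul_le_mul_left (hw2 j) _
        · refine ENNReal.tsum_le_tsum fun j => ?_
          rw [mul_left_comm]
          gcongr
          exact hwle j
    _ = _ := by
        rw [ENNReal.ofReal_mul two_pos.le, ENNReal.ofReal_ofNat, mul_assoc]
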